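/- Let $n\ge 3$ agents $1,\dots,n$ and a finite set $M$ of $m$ indivisible items be given, and let each agent $i$ have a valuation function $v_i\colon 2^M\to\mathbb{R}$ that is monotone and whose marginal values are at most one, i.e. $0\le v_i(X\cup\{e\})-v_i(X)\le 1$ for all $X\subseteq M$ and $e\in M\setminus X$. Then there exist an ordered partition $(A_1,\dots,A_n)$ of $M$ (parts may be empty) and a subsidy vector $(p_1,\dots,p_n)\in\mathbb{R}_{\ge 0}^n$ that are envy-free, i.e. $v_i(A_i)+p_i\ge v_i(A_j)+p_j$ for all $i,j$, and satisfy $\max_{i}p_i\le n-1.5$ and $\sum_{i}p_i\le (n^2-n-1)/2$. Moreover, such an envy-free allocation with a subsidy can be computed in polynomial time when the valuations are given by value oracles: there is a single algorithm (a random access machine whose unit-cost operations are assignments, tests, and additions, subtractions and comparisons of natural numbers and of real numbers, and which may query the value $v_i(X)$ of any agent $i$ and set $X$ at the cost of $m+1$ steps) that, on input $n$ and $m$ and with oracles for $v_1,\dots,v_n$ as above, outputs such a pair after a number of steps bounded by a fixed polynomial in $n+m$. -/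

import Mathlib

namespace FairDivision

/-! ### Instances, allocations and subsidies -/

/-- A profile of valuation functions of `n` agents over subsets of `m` indivisible items. -/
abbrev Valuations (n m : ℕ) : Type := Fin n → Finset (Fin m) → ℝ

/-- The marginal contribution of each item is, in absolute value, at most one. -/
def MarginalsAtMostOne {n m : ℕ} (v : Valuations n m) : Prop :=
  ∀ (i : Fin n) (e : Fin m) (X : Finset (Fin m)), e ∉ X → |v i (insert e X) - v i X| ≤ 1

/-- Item `e` is a good for agent `i`. -/
def IsGood {n m : ℕ} (v : Valuations n m) (e : Fin m) (i : Fin n) : Prop :=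
  ∀ X : Finset (Fin m), e ∉ X → v i X ≤ v i (insert e X)

/-- The instance is monotone: every item is a good for every agent. -/
def IsMonotoneInstance {n m : ℕ} (v : Valuations n m) : Prop :=
  ∀ (e : Fin m) (i : Fin n), IsGood v e i

/-- `A` is an allocation: an ordered partition (with possibly empty parts) of all the items. -/
def IsAllocation {n m : ℕ} (A : Fin n → Finset (Fin m)) : Prop :=
  Finset.univ.biUnion A = Finset.univ ∧ ∀ i j : Fin n, i ≠ j → Disjoint (A i) (A j)

/-- `p` is a subsidy vector: it is non-negative. -/
def IsSubsidy {n : ℕ} (p : Fin n → ℝ) : Prop :=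
  ∀ i, 0 ≤ p i

/-- The allocation `A` with the subsidy `p` is envy-free. -/
def IsEnvyFree {n m : ℕ} (v : Valuations n m) (A : Fin n → Finset (Fin m)) (p : Fin n → ℝ) :
    Prop :=
  ∀ i j : Fin n, v i (A j) + p j ≤ v i (A i) + p i

/-- `(A, p)` is an envy-free allocation with a subsidy, each agent is paid at most `n - 1.5`, and
the payments sum to at most `(n ^ 2 - n - 1) / 2`. -/
def IsDesired {n m : ℕ} (v : Valuations n m) (A : Fin n → Finset (Fin m)) (p : Fin n → ℝ) :
    Prop :=
  IsAllocation A ∧ IsSubsidy p ∧ IsEnvyFree v A p ∧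
    (∀ i, p i ≤ (n : ℝ) - 3 / 2) ∧
    ∑ i, p i ≤ ((n : ℝ) ^ 2 - (n : ℝ) - 1) / 2

/-! ### Programs with access to value oracles, and their running time

A random access machine, given as a structured programming language.  The memory holds scalars
and two-dimensional arrays of natural numbers and of real numbers.  The arithmetic is restricted
to additions, subtractions and comparisons, so that unit cost is not an unrealistic measure of
time (no multiplication, no rounding, and a real number can be examined only by comparing it).
Names of scalars and arrays are literals of the program, so one program uses finitely many. -/

/-- The memory. -/
structure Store where
  /-- scalar variables for natural numbers -/
  nvar : ℕ → ℕ
  /-- scalar variables for real numbers -/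
  rvar : ℕ → ℝ
  /-- `narr a i j` is the entry `(i, j)` of the `a`-th array of natural numbers -/
  narr : ℕ → ℕ → ℕ → ℕ
  /-- `rarr a i j` is the entry `(i, j)` of the `a`-th array of real numbers -/
  rarr : ℕ → ℕ → ℕ → ℝ

namespace Store

/-- Assign the natural number `k` to the scalar `x`. -/
def setN (s : Store) (x k : ℕ) : Store :=
  { s with nvar := fun y => if y = x then k else s.nvar y }

/-- Assign the real number `r` to the scalar `x`. -/
def setR (s : Store) (x : ℕ) (r : ℝ) : Store :=
  { s with rvar := fun y => if y = x then r else s.rvar y }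

/-- Assign the natural number `k` to the entry `(i, j)` of the array `a`. -/
def storeN (s : Store) (a i j k : ℕ) : Store :=
  { s with narr := fun a' i' j' => if a' = a ∧ i' = i ∧ j' = j then k else s.narr a' i' j' }

/-- Assign the real number `r` to the entry `(i, j)` of the array `a`. -/
def storeR (s : Store) (a i j : ℕ) (r : ℝ) : Store :=
  { s with rarr := fun a' i' j' => if a' = a ∧ i' = i ∧ j' = j then r else s.rarr a' i' j' }

/-- The set of items whose characteristic vector is row `k` of the array `a`. -/
def bundle (m : ℕ) (s : Store) (a k : ℕ) : Finset (Fin m) :=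
  Finset.univ.filter fun e => s.narr a k e ≠ 0

end Store

/-- Expressions for natural numbers (subtraction is truncated at zero). -/
inductive NExp where
  | lit (k : ℕ)
  | var (x : ℕ)
  | arr (a : ℕ) (i j : NExp)
  | add (e f : NExp)
  | sub (e f : NExp)

/-- The value of an expression for a natural number. -/
def NExp.eval (s : Store) : NExp → ℕ
  | .lit k => k
  | .var x => s.nvar x
  | .arr a i j => s.narr a (i.eval s) (j.eval s)
  | .add e f => e.eval s + f.eval s
  | .sub e f => e.eval s - f.eval s

/-- Expressions for real numbers. -/
inductive RExp where
  | zero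
  | one
  | var (x : ℕ)
  | arr (a : ℕ) (i j : NExp)
  | add (e f : RExp)
  | sub (e f : RExp)

/-- The value of an expression for a real number. -/
def RExp.eval (s : Store) : RExp → ℝ
  | .zero => 0
  | .one => 1
  | .var x => s.rvar x
  | .arr a i j => s.rarr a (i.eval s) (j.eval s)
  | .add e f => e.eval s + f.eval s
  | .sub e f => e.eval s - f.eval s

/-- Tests: comparisons of numbers, and their Boolean combinations. -/
inductive Test where
  | nle (e f : NExp)
  | rle (e f : RExp)
  | not (b : Test)
  | and (b c : Test)

/-- The truth value of a test. -/
def Test.Holds (s : Store) : Test → Prop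
  | .nle e f => e.eval s ≤ f.eval s
  | .rle e f => e.eval s ≤ f.eval s
  | .not b => ¬ b.Holds s
  | .and b c => b.Holds s ∧ c.Holds s

/-- Programs.  `query x i a k` asks the value oracle of agent `i` for the value of the set of
items whose characteristic vector is row `k` of the array `a`, and stores the answer in the real
scalar `x`. -/
inductive Program where
  | skip
  | setN (x : ℕ) (e : NExp)
  | setR (x : ℕ) (e : RExp)
  | storeN (a : ℕ) (i j : NExp) (e : NExp)
  | storeR (a : ℕ) (i j : NExp) (e : RExp)
  | query (x : ℕ) (i : NExp) (a : ℕ) (k : NExp)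
  | seq (P Q : Program)
  | cond (b : Test) (P Q : Program)
  | loop (b : Test) (P : Program)

/-- The answer of the value oracles; the agents are numbered from `0` to `n - 1`, and a query
about any other agent is answered by `0`. -/
noncomputable def oracle {n m : ℕ} (v : Valuations n m) (i : ℕ) (X : Finset (Fin m)) : ℝ :=
  if h : i < n then v ⟨i, h⟩ X else 0

/-- `Exec v P s T s'`: with value oracles for `v`, the program `P`, started in the memory `s`,
halts after exactly `T` time steps, with the memory `s'`.  Every assignment and every test costs
one step, and an oracle query costs one step plus one step per item (for reading the set). -/
inductive Exec {n m : ℕ} (v : Valuations n m) : Program → Store → ℕ → Store → Prop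
  | skip (s : Store) : Exec v .skip s 1 s
  | setN (s : Store) (x : ℕ) (e : NExp) :
      Exec v (.setN x e) s 1 (s.setN x (e.eval s))
  | setR (s : Store) (x : ℕ) (e : RExp) :
      Exec v (.setR x e) s 1 (s.setR x (e.eval s))
  | storeN (s : Store) (a : ℕ) (i j e : NExp) :
      Exec v (.storeN a i j e) s 1 (s.storeN a (i.eval s) (j.eval s) (e.eval s))
  | storeR (s : Store) (a : ℕ) (i j : NExp) (e : RExp) :
      Exec v (.storeR a i j e) s 1 (s.storeR a (i.eval s) (j.eval s) (e.eval s))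
  | query (s : Store) (x : ℕ) (i : NExp) (a : ℕ) (k : NExp) :
      Exec v (.query x i a k) s (m + 1)
        (s.setR x (oracle v (i.eval s) (s.bundle m a (k.eval s))))
  | seq {P Q : Program} {s s' s'' : Store} {T T' : ℕ} (hP : Exec v P s T s')
      (hQ : Exec v Q s' T' s'') : Exec v (.seq P Q) s (T + T') s''
  | cond_true {b : Test} {P Q : Program} {s s' : Store} {T : ℕ} (hb : b.Holds s)
      (hP : Exec v P s T s') : Exec v (.cond b P Q) s (T + 1) s'
  | cond_false {b : Test} {P Q : Program} {s s' : Store} {T : ℕ} (hb : ¬ b.Holds s)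
      (hQ : Exec v Q s T s') : Exec v (.cond b P Q) s (T + 1) s'
  | loop_done {b : Test} {P : Program} {s : Store} (hb : ¬ b.Holds s) :
      Exec v (.loop b P) s 1 s
  | loop_step {b : Test} {P : Program} {s s' s'' : Store} {T T' : ℕ} (hb : b.Holds s)
      (hP : Exec v P s T s') (hL : Exec v (.loop b P) s' T' s'') :
      Exec v (.loop b P) s (T + T' + 1) s''

/-- Programs are deterministic: the running time and the final memory are unique. -/
theorem Exec.unique {n m : ℕ} {v : Valuations n m} {P : Program} {s s₁ s₂ : Store} {T₁ T₂ : ℕ}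
    (h₁ : Exec v P s T₁ s₁) (h₂ : Exec v P s T₂ s₂) : T₁ = T₂ ∧ s₁ = s₂ := by
  induction h₁ generalizing T₂ s₂ with
  | skip | setN | setR | storeN | storeR | query => cases h₂; exact ⟨rfl, rfl⟩
  | seq _ _ ih ih' =>
    cases h₂ with
    | seq hP hQ =>
      obtain ⟨rfl, rfl⟩ := ih hP
      obtain ⟨rfl, rfl⟩ := ih' hQ
      exact ⟨rfl, rfl⟩
  | cond_true hb _ ih =>
    cases h₂ with
    | cond_true _ h => obtain ⟨rfl, rfl⟩ := ih h; exact ⟨rfl, rfl⟩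
    | cond_false hb' _ => exact absurd hb hb'
  | cond_false hb _ ih =>
    cases h₂ with
    | cond_true hb' _ => exact absurd hb' hb
    | cond_false _ h => obtain ⟨rfl, rfl⟩ := ih h; exact ⟨rfl, rfl⟩
  | loop_done hb =>
    cases h₂ with
    | loop_done _ => exact ⟨rfl, rfl⟩
    | loop_step hb' _ _ => exact absurd hb' hb
  | loop_step hb _ _ ih ih' =>
    cases h₂ with
    | loop_done hb' => exact absurd hb hb'
    | loop_step _ hP hL =>
      obtain ⟨rfl, rfl⟩ := ih hP
      obtain ⟨rfl, rfl⟩ := ih' hL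
      exact ⟨rfl, rfl⟩

/-- The initial memory: the natural scalars `0` and `1` hold the number `n` of agents and the
number `m` of items, everything else is zero.  (The valuations are accessible only through
queries.) -/
def initialStore (n m : ℕ) : Store where
  nvar := fun x => if x = 0 then n else if x = 1 then m else 0
  rvar := fun _ => 0
  narr := fun _ _ _ => 0
  rarr := fun _ _ _ => 0

/-- The bundles in the output: the characteristic vector of the bundle of agent `i` is row `i` of
the natural array `0`. -/
def outputBundles (n m : ℕ) (s : Store) : Fin n → Finset (Fin m) :=
  fun i => s.bundle m 0 i

/-- The payments in the output: the payment to agent `i` is entry `(0, i)` of the real array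
`0`. -/
def outputSubsidy (n : ℕ) (s : Store) : Fin n → ℝ :=
  fun i => s.rarr 0 0 i

end FairDivision

/-! Bundles are built first and priced afterwards. Items are inserted one at a time. Each round
computes envy-free prices, with a matching, for valuations that penalize any agent's loss. Then
nobody is worse off, and nobody envies the most expensive bundle even when prices are ignored
(`improves_of_slack`). The new item goes into that bundle, so dropping one item always removes all
envy of a bundle, and under a reference assignment envy is at most one.

For true valuations, minimal prices are characterized by paths of tight envy to price zero. The main
tool is a Hall-type argument, `MinimalPrices.cut`: if `T` is a set of positively priced bundles,
some `|T|` agents cannot all refuse every bundle outside `T`. With envy at most one, every positive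
price has a smaller price within distance one, so each price is at most the number of cheaper
bundles. If moreover the largest price is at most `n - 3/2`, the sum bound follows from
`(n-1)(n-2)/2 + n - 3/2 = (n^2-n-1)/2`.

If the largest price exceeds `n - 3/2`, the descent has no room to spare: all prices are more than
`1/2` apart (`MinimalPrices.gap`). Consequently nobody envies the dearest bundle `s` in the
reference assignment, and the reference agent of the cheapest bundle `t` demands it at price zero.
Moving the last item of `t` to `s` keeps envy at most one, makes `t` unenvied, and leaves agent `t`
with envy at most `1/2` (`LargePrices.moveItem`). New minimal prices then obey the bound
(`MinimalPrices.le_of_unenvied`).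

Matchings and prices come from a Hungarian method: `growP` lowers prices until tight envy forms a
tree, and `rotateP` reassigns along a tree path. An extra bundle as root of a last tree makes the
prices minimal. Every loop makes at most `n + m + 1` rounds, so the syntactic bound `Program.cost`
is polynomial. Existence is read off from the output. -/

namespace FairDivision

variable {n m : ℕ} {v : Valuations n m} {K : ℕ}

/-! ### A calculus for programs with a syntactic time bound -/

/-- The running time of a program each of whose loops makes at most `K` rounds whenever it is
reached, where `K` also bounds the price of a query. -/
def Program.cost (K : ℕ) : Program → ℕ
  | .skip | .setN _ _ | .setR _ _ | .storeN _ _ _ _ | .storeR _ _ _ _ => 1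
  | .query _ _ _ _ => K
  | .seq P Q => P.cost K + Q.cost K
  | .cond _ P Q => P.cost K + Q.cost K + 1
  | .loop _ P => K * (P.cost K + 1) + 1

/-- The syntactic time bound is polynomial. -/
theorem Program.cost_le (P : Program) : ∃ C d : ℕ, ∀ K, 1 ≤ K → P.cost K ≤ C * K ^ d := by
  have key : ∀ (C d C' d' K : ℕ), 1 ≤ K →
      C * K ^ d + C' * K ^ d' ≤ (C + C') * K ^ (d + d') := by
    intro C d C' d' K hK
    have h1 : K ^ d ≤ K ^ (d + d') := Nat.pow_le_pow_right hK (by omega)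
    have h2 : K ^ d' ≤ K ^ (d + d') := Nat.pow_le_pow_right hK (by omega)
    nlinarith [Nat.mul_le_mul_left C h1, Nat.mul_le_mul_left C' h2]
  induction P with
  | skip | setN | setR | storeN | storeR => exact ⟨1, 0, fun K _ => by simp [Program.cost]⟩
  | query => exact ⟨1, 1, fun K _ => by simp [Program.cost]⟩
  | seq P Q ihP ihQ =>
    obtain ⟨C, d, h⟩ := ihP
    obtain ⟨C', d', h'⟩ := ihQ
    exact ⟨C + C', d + d', fun K hK =>
      (Nat.add_le_add (h K hK) (h' K hK)).trans (key C d C' d' K hK)⟩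
  | cond b P Q ihP ihQ =>
    obtain ⟨C, d, h⟩ := ihP
    obtain ⟨C', d', h'⟩ := ihQ
    refine ⟨C + C' + 1, d + d', fun K hK => ?_⟩
    have h1 := (Nat.add_le_add (h K hK) (h' K hK)).trans (key C d C' d' K hK)
    have h2 : 1 ≤ K ^ (d + d') := Nat.one_le_pow _ _ hK
    simp only [Program.cost]
    nlinarith
  | loop b P ih =>
    obtain ⟨C, d, h⟩ := ih
    refine ⟨C + 2, d + 1, fun K hK => ?_⟩
    have h2 : 1 ≤ K ^ d := Nat.one_le_pow _ _ hK
    have h3 : K * (P.cost K + 1) ≤ K * (C * K ^ d + K ^ d) :=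
      Nat.mul_le_mul_left K (Nat.add_le_add (h K hK) h2)
    have h4 : 1 ≤ K ^ (d + 1) := Nat.one_le_pow _ _ hK
    simp only [Program.cost]
    calc K * (P.cost K + 1) + 1 ≤ K * (C * K ^ d + K ^ d) + K ^ (d + 1) := by omega
      _ = (C + 2) * K ^ (d + 1) := by ring

/-- The natural scalars that a program writes. -/
def Program.nvars : Program → List ℕ
  | .setN x _ => [x]
  | .seq P Q | .cond _ P Q => P.nvars ++ Q.nvars
  | .loop _ P => P.nvars
  | _ => []

/-- The real scalars that a program writes. -/
def Program.rvars : Program → List ℕ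
  | .setR x _ | .query x _ _ _ => [x]
  | .seq P Q | .cond _ P Q => P.rvars ++ Q.rvars
  | .loop _ P => P.rvars
  | _ => []

/-- The natural arrays that a program writes. -/
def Program.narrs : Program → List ℕ
  | .storeN a _ _ _ => [a]
  | .seq P Q | .cond _ P Q => P.narrs ++ Q.narrs
  | .loop _ P => P.narrs
  | _ => []

/-- The real arrays that a program writes. -/
def Program.rarrs : Program → List ℕ
  | .storeR a _ _ _ => [a]
  | .seq P Q | .cond _ P Q => P.rarrs ++ Q.rarrs
  | .loop _ P => P.rarrs
  | _ => []

/-- The memories `s` and `s'` agree wherever the program `P` does not write. -/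
structure Framed (P : Program) (s s' : Store) : Prop where
  nvar : ∀ x, x ∉ P.nvars → s'.nvar x = s.nvar x
  rvar : ∀ x, x ∉ P.rvars → s'.rvar x = s.rvar x
  narr : ∀ a, a ∉ P.narrs → s'.narr a = s.narr a
  rarr : ∀ a, a ∉ P.rarrs → s'.rarr a = s.rarr a

theorem Framed.refl (P : Program) (s : Store) : Framed P s s :=
  ⟨fun _ _ => rfl, fun _ _ => rfl, fun _ _ => rfl, fun _ _ => rfl⟩

theorem Framed.trans {P : Program} {s s' s'' : Store} (h : Framed P s s') (h' : Framed P s' s'') :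
    Framed P s s'' :=
  ⟨fun x hx => (h'.nvar x hx).trans (h.nvar x hx), fun x hx => (h'.rvar x hx).trans (h.rvar x hx),
    fun x hx => (h'.narr x hx).trans (h.narr x hx), fun x hx => (h'.rarr x hx).trans (h.rarr x hx)⟩

theorem Framed.mono {P Q : Program} {s s' : Store} (h : Framed P s s')
    (h1 : P.nvars ⊆ Q.nvars) (h2 : P.rvars ⊆ Q.rvars) (h3 : P.narrs ⊆ Q.narrs)
    (h4 : P.rarrs ⊆ Q.rarrs) : Framed Q s s' :=
  ⟨fun x hx => h.nvar x fun h => hx (h1 h), fun x hx => h.rvar x fun h => hx (h2 h),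
    fun x hx => h.narr x fun h => hx (h3 h), fun x hx => h.rarr x fun h => hx (h4 h)⟩

/-- Memory changes only at names that occur syntactically in the program, so untouched data can
later be recovered by deciding membership in explicit lists. -/
theorem Exec.framed {P : Program} {s s' : Store} {T : ℕ} (h : Exec v P s T s') :
    Framed P s s' := by
  induction h with
  | skip | loop_done => exact Framed.refl _ _
  | setN s x e =>
    refine ⟨fun y hy => ?_, fun _ _ => rfl, fun _ _ => rfl, fun _ _ => rfl⟩
    simp only [Program.nvars, List.mem_singleton] at hy
    simp [Store.setN, hy]
  | setR s x e =>
    refine ⟨fun _ _ => rfl, fun y hy => ?_, fun _ _ => rfl, fun _ _ => rfl⟩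
    simp only [Program.rvars, List.mem_singleton] at hy
    simp [Store.setR, hy]
  | storeN s a i j e =>
    refine ⟨fun _ _ => rfl, fun _ _ => rfl, fun y hy => ?_, fun _ _ => rfl⟩
    simp only [Program.narrs, List.mem_singleton] at hy
    simp [Store.storeN, hy]
  | storeR s a i j e =>
    refine ⟨fun _ _ => rfl, fun _ _ => rfl, fun _ _ => rfl, fun y hy => ?_⟩
    simp only [Program.rarrs, List.mem_singleton] at hy
    simp [Store.storeR, hy]
  | query s x i a k =>
    refine ⟨fun _ _ => rfl, fun y hy => ?_, fun _ _ => rfl, fun _ _ => rfl⟩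
    simp only [Program.rvars, List.mem_singleton] at hy
    simp [Store.setR, hy]
  | seq _ _ ih ih' =>
    refine (ih.mono ?_ ?_ ?_ ?_).trans (ih'.mono ?_ ?_ ?_ ?_) <;>
      simp [Program.nvars, Program.rvars, Program.narrs, Program.rarrs]
  | cond_true _ _ ih | cond_false _ _ ih =>
    refine ih.mono ?_ ?_ ?_ ?_ <;>
      simp [Program.nvars, Program.rvars, Program.narrs, Program.rarrs]
  | loop_step _ _ _ ih ih' =>
    exact (ih.mono (by simp [Program.nvars]) (by simp [Program.rvars]) (by simp [Program.narrs])
      (by simp [Program.rarrs])).trans ih'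

/-- Started in `s`, the program `P` halts within its syntactic time bound for `K`, in a memory that
satisfies `Q`. -/
def Runs (v : Valuations n m) (K : ℕ) (P : Program) (s : Store) (Q : Store → Prop) : Prop :=
  ∃ t s', Exec v P s t s' ∧ t ≤ P.cost K ∧ Q s'

namespace Runs

variable {P P' : Program} {s : Store} {Q Q' : Store → Prop}

/-- The frame is supplied to the weakening step, so a specification need only mention what the
program computes. -/
theorem mono (h : Runs v K P s Q) (hQ : ∀ s', Framed P s s' → Q s' → Q' s') :
    Runs v K P s Q' := by
  obtain ⟨t, s', he, ht, hq⟩ := h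
  exact ⟨t, s', he, ht, hQ s' he.framed hq⟩

theorem skip (h : Q s) : Runs v K .skip s Q := ⟨1, s, .skip s, le_rfl, h⟩

theorem setN {x : ℕ} {e : NExp} (h : Q (s.setN x (e.eval s))) : Runs v K (.setN x e) s Q :=
  ⟨1, _, .setN s x e, le_rfl, h⟩

theorem setR {x : ℕ} {e : RExp} (h : Q (s.setR x (e.eval s))) : Runs v K (.setR x e) s Q :=
  ⟨1, _, .setR s x e, le_rfl, h⟩

theorem storeN {a : ℕ} {i j e : NExp} (h : Q (s.storeN a (i.eval s) (j.eval s) (e.eval s))) :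
    Runs v K (.storeN a i j e) s Q :=
  ⟨1, _, .storeN s a i j e, le_rfl, h⟩

theorem storeR {a : ℕ} {i j : NExp} {e : RExp}
    (h : Q (s.storeR a (i.eval s) (j.eval s) (e.eval s))) :
    Runs v K (.storeR a i j e) s Q :=
  ⟨1, _, .storeR s a i j e, le_rfl, h⟩

theorem query (hK : m + 1 ≤ K) {x a : ℕ} {i k : NExp}
    (h : Q (s.setR x (oracle v (i.eval s) (s.bundle m a (k.eval s))))) :
    Runs v K (.query x i a k) s Q :=
  ⟨m + 1, _, .query s x i a k, hK, h⟩

theorem seq (h : Runs v K P s fun s' => Runs v K P' s' Q) : Runs v K (.seq P P') s Q := by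
  obtain ⟨t, s', he, ht, t', s'', he', ht', hq⟩ := h
  exact ⟨t + t', s'', .seq he he', Nat.add_le_add ht ht', hq⟩

theorem seq' (h : Runs v K P s Q') (h' : ∀ s', Framed P s s' → Q' s' → Runs v K P' s' Q) :
    Runs v K (.seq P P') s Q :=
  seq (h.mono h')

theorem cond {b : Test} (h : b.Holds s → Runs v K P s Q) (h' : ¬ b.Holds s → Runs v K P' s Q) :
    Runs v K (.cond b P P') s Q := by
  by_cases hb : b.Holds s
  · obtain ⟨t, s', he, ht, hq⟩ := h hb
    exact ⟨t + 1, s', .cond_true hb he, by simp only [Program.cost]; omega, hq⟩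
  · obtain ⟨t, s', he, ht, hq⟩ := h' hb
    exact ⟨t + 1, s', .cond_false hb he, by simp only [Program.cost]; omega, hq⟩

/-- The rule for loops: `I k` is an invariant after which at most `k` further rounds are made. -/
theorem loop {b : Test} (I : ℕ → Store → Prop) {N : ℕ} (hN : N ≤ K) (h0 : I N s)
    (hs : ∀ k s', Framed (.loop b P) s s' → I k s' → b.Holds s' →
      0 < k ∧ Runs v K P s' (I (k - 1)))
    (hQ : ∀ k s', Framed (.loop b P) s s' → I k s' → ¬ b.Holds s' → Q s') :
    Runs v K (.loop b P) s Q := by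
  have key : ∀ k s', Framed (.loop b P) s s' → I k s' →
      ∃ t s'', Exec v (.loop b P) s' t s'' ∧ t ≤ k * (P.cost K + 1) + 1 ∧ Q s'' := by
    intro k
    induction k with
    | zero =>
      intro s' hf hI
      exact ⟨1, s', .loop_done fun hb => (hs 0 s' hf hI hb).1.false, by omega,
        hQ 0 s' hf hI fun hb => (hs 0 s' hf hI hb).1.false⟩
    | succ k ih =>
      intro s' hf hI
      by_cases hb : b.Holds s'
      · obtain ⟨t, s1, he, ht, h1⟩ := (hs (k + 1) s' hf hI hb).2
        have hf' : Framed (.loop b P) s s1 := hf.trans (he.framed.mono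
          (by simp [Program.nvars]) (by simp [Program.rvars]) (by simp [Program.narrs])
          (by simp [Program.rarrs]))
        obtain ⟨t', s2, he', ht', h2⟩ := ih s1 hf' h1
        refine ⟨t + t' + 1, s2, .loop_step hb he he', ?_, h2⟩
        rw [Nat.succ_mul]
        omega
      · exact ⟨1, s', .loop_done hb, by omega, hQ _ s' hf hI hb⟩
  obtain ⟨t, s', he, ht, hq⟩ := key N s (Framed.refl _ _) h0
  refine ⟨t, s', he, ht.trans ?_, hq⟩
  simp only [Program.cost]
  exact Nat.succ_le_succ (Nat.mul_le_mul_right _ hN)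

end Runs

/-- `e < f` -/
def Test.nlt (e f : NExp) : Test := .nle (.add e (.lit 1)) f

/-- `e = f` -/
def Test.neq (e f : NExp) : Test := .and (.nle e f) (.nle f e)

/-- `b` or `c` -/
def Test.or (b c : Test) : Test := .not (.and (.not b) (.not c))

@[simp] theorem Test.holds_nlt {s : Store} {e f : NExp} :
    (Test.nlt e f).Holds s ↔ e.eval s < f.eval s := Iff.rfl

@[simp] theorem Test.holds_neq {s : Store} {e f : NExp} :
    (Test.neq e f).Holds s ↔ e.eval s = f.eval s := by
  simp [Test.neq, Test.Holds, le_antisymm_iff]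

@[simp] theorem Test.holds_or {s : Store} {b c : Test} :
    (Test.or b c).Holds s ↔ b.Holds s ∨ c.Holds s := by
  simp only [Test.or, Test.Holds]; tauto

/-- Run `P` for `x = 0, 1, …, e - 1`. -/
def Program.forTo (x : ℕ) (e : NExp) (P : Program) : Program :=
  .seq (.setN x (.lit 0)) (.loop (.nlt (.var x) e) (.seq P (.setN x (.add (.var x) (.lit 1)))))

theorem Framed.setN {P : Program} (s : Store) (x k : ℕ) (hx : x ∈ P.nvars) :
    Framed P s (s.setN x k) := by
  refine ⟨fun y hy => ?_, fun _ _ => rfl, fun _ _ => rfl, fun _ _ => rfl⟩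
  have : y ≠ x := by rintro rfl; exact hy hx
  simp [Store.setN, this]

/-- The rule for counting loops. -/
theorem Runs.forTo {P : Program} {s : Store} {x : ℕ} {e : NExp} (N : ℕ) (I : ℕ → Store → Prop)
    (hx : x ∉ P.nvars) (hN : N ≤ K) (he : ∀ s', Framed (.forTo x e P) s s' → e.eval s' = N)
    (h0 : I 0 (s.setN x 0))
    (hs : ∀ k s', k < N → s'.nvar x = k → Framed (.forTo x e P) s s' → I k s' →
      Runs v K P s' fun s'' => I (k + 1) (s''.setN x (k + 1))) :
    Runs v K (.forTo x e P) s fun s' => s'.nvar x = N ∧ I N s' := by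
  have hmem : x ∈ (Program.forTo x e P).nvars := by simp [Program.forTo, Program.nvars]
  refine Runs.seq (Runs.setN ?_)
  -- `Runs.loop` counts the rounds that remain, so its counter `k` corresponds to the value `N - k`
  -- of the loop variable.
  refine Runs.loop (fun k s' => k ≤ N ∧ s'.nvar x = N - k ∧ Framed (.forTo x e P) s s' ∧
    I (N - k) s') hN ⟨le_rfl,
    by simp [Store.setN, NExp.eval], Framed.setN _ _ _ hmem, by simpa [NExp.eval] using h0⟩ ?_ ?_
  · rintro k s' - ⟨hk, hxk, hf, hI⟩ hb
    rw [Test.holds_nlt, he s' hf] at hb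
    simp only [NExp.eval] at hb
    refine ⟨by omega, Runs.seq ((hs (N - k) s' (by omega) hxk hf hI).mono fun s1 hf1 h1 => ?_)⟩
    have e1 : (NExp.add (.var x) (.lit 1)).eval s1 = N - k + 1 := by
      simp [NExp.eval, hf1.nvar x hx, hxk]
    refine Runs.setN ?_
    rw [e1]
    refine ⟨by omega, ?_, ?_, ?_⟩
    · simp only [Store.setN, if_true]; omega
    · exact (hf.trans (hf1.mono (by simp [Program.forTo, Program.nvars])
        (by simp [Program.forTo, Program.rvars]) (by simp [Program.forTo, Program.narrs])
        (by simp [Program.forTo, Program.rarrs]))).trans (Framed.setN _ _ _ hmem)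
    · have : N - (k - 1) = N - k + 1 := by omega
      rw [this]; exact h1
  · rintro k s' - ⟨hk, hxk, hf, hI⟩ hb
    rw [Test.holds_nlt, he s' hf] at hb
    simp only [NExp.eval] at hb
    have : k = 0 := by omega
    subst this
    exact ⟨by simpa using hxk, by simpa using hI⟩

@[simp] theorem Program.nvars_forTo (x : ℕ) (e : NExp) (P : Program) :
    (Program.forTo x e P).nvars = x :: (P.nvars ++ [x]) := rfl

@[simp] theorem Program.rvars_forTo (x : ℕ) (e : NExp) (P : Program) :
    (Program.forTo x e P).rvars = P.rvars := by simp [Program.forTo, Program.rvars]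

@[simp] theorem Program.narrs_forTo (x : ℕ) (e : NExp) (P : Program) :
    (Program.forTo x e P).narrs = P.narrs := by simp [Program.forTo, Program.narrs]

@[simp] theorem Program.rarrs_forTo (x : ℕ) (e : NExp) (P : Program) :
    (Program.forTo x e P).rarrs = P.rarrs := by simp [Program.forTo, Program.rarrs]

/-! ### Minimal envy-free prices of bundles -/

section Prices

variable {ι : Type*}

/-- The prices `q` are envy-free for the assignment `π` of agents to bundles, and from every bundle
a path of tight envy leads to a bundle of price zero.  (Such prices are the least envy-free ones.)
`w i a` is the value of the bundle `a` for the agent `i`. -/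
structure MinimalPrices (w : ι → ι → ℝ) (π : Equiv.Perm ι) (q : ι → ℝ) : Prop where
  nonneg : ∀ a, 0 ≤ q a
  demand : ∀ a b, w (π a) b + q b ≤ w (π a) a + q a
  reach : ∃ R : ι → ℕ, ∀ a, q a = 0 ∨ ∃ b, R b < R a ∧ w (π a) b + q b = w (π a) a + q a

variable {w : ι → ι → ℝ} {π : Equiv.Perm ι} {q : ι → ℝ}

/-- The prices of a set `T` of bundles cannot all be positive if as many agents as there are bundles
in `T` demand no bundle outside `T`. -/
theorem MinimalPrices.cut (h : MinimalPrices w π q) {T S : Finset ι} (hT : T.Nonempty)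
    (hST : S.card = T.card) (hq : ∀ a ∈ T, 0 < q a)
    (hd : ∀ i ∈ S, ∀ b ∉ T, ∃ a, w i b + q b < w i a + q a) : False := by
  classical
  -- Every agent demands the bundle it holds, so the agents of `S` hold bundles of `T`; by
  -- cardinality they hold exactly those.
  have hsub : S.map π.symm.toEmbedding ⊆ T := by
    intro b hb
    obtain ⟨i, hi, rfl⟩ := Finset.mem_map.1 hb
    by_contra hbT
    obtain ⟨a, ha⟩ := hd i hi _ hbT
    have := h.demand (π.symm i) a
    simp only [Equiv.apply_symm_apply] at this
    exact absurd ha (not_lt.2 this)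
  have heq : S.map π.symm.toEmbedding = T :=
    Finset.eq_of_subset_of_card_le hsub (by simp [hST])
  obtain ⟨R, hR⟩ := h.reach
  -- From a bundle of least rank in `T`, tight envy leads out of `T`, to a bundle that its holder, a
  -- member of `S`, would have to demand.
  obtain ⟨a, haT, hmin⟩ := T.exists_min_image R hT
  have haS : π a ∈ S := by
    rw [← heq] at haT
    obtain ⟨i, hi, rfl⟩ := Finset.mem_map.1 haT
    simpa using hi
  rcases hR a with h0 | ⟨b, hb, hab⟩
  · exact (hq a haT).ne' h0
  · by_cases hbT : b ∈ T
    · exact absurd hb (not_lt.2 (hmin b hbT))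
    · obtain ⟨c, hc⟩ := hd _ haS b hbT
      linarith [h.demand a c]

variable [Fintype ι]

/-- Every agent `i` envies every bundle at most by one when holding the bundle `i`. -/
def EnvyAtMostOne {ι : Type*} (w : ι → ι → ℝ) : Prop := ∀ i a, w i a ≤ w i i + 1

/-- Otherwise every price below `q a` is smaller by more than one. That gap outweighs any envy, so
the agents with the same indices as the bundles priced at least `q a` refuse all cheaper bundles,
contrary to `cut`. -/
theorem MinimalPrices.exists_below (h : MinimalPrices w π q) (hw : EnvyAtMostOne w) (a : ι)
    (ha : 0 < q a) : ∃ j, q j < q a ∧ q a ≤ q j + 1 := by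
  by_contra! hno
  refine h.cut (T := {b | q a ≤ q b}) (S := {b | q a ≤ q b}) ⟨a, by simp⟩ rfl ?_ ?_
  · intro b hb
    simp only [Finset.mem_filter, Finset.mem_univ, true_and] at hb
    linarith
  · intro i hi b hb
    simp only [Finset.mem_filter, Finset.mem_univ, true_and, not_le] at hi hb
    exact ⟨i, by linarith [hno b hb, hw i b]⟩

/-- Improvement of `exists_below` in the presence of an unenvied bundle. -/
theorem MinimalPrices.exists_below_ne (h : MinimalPrices w π q) (hw : EnvyAtMostOne w) {t : ι}
    (ht : ∀ i, w i t ≤ w i i) (a : ι) (ha : 0 < q a) :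
    ∃ j, j ≠ t ∧ q j < q a ∧ q a ≤ q j + 1 := by
  by_contra! hno
  refine h.cut (T := {b | q a ≤ q b}) (S := {b | q a ≤ q b}) ⟨a, by simp⟩ rfl ?_ ?_
  · intro b hb
    simp only [Finset.mem_filter, Finset.mem_univ, true_and] at hb
    linarith
  · intro i hi b hb
    simp only [Finset.mem_filter, Finset.mem_univ, true_and, not_le] at hi hb
    refine ⟨i, ?_⟩
    -- An unenvied bundle is refused as soon as it is strictly cheaper, so no gap of one is needed
    -- for `t`.
    rcases eq_or_ne b t with rfl | hbt
    · linarith [ht i]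
    · linarith [hno b hbt hb, hw i b]

open Finset in
theorem card_filter_lt_succ_le {ι : Type*} {q : ι → ℝ} {U : Finset ι} {j a : ι} (hj : j ∈ U)
    (hja : q j < q a) :
    #{b ∈ U | q b < q j} + 1 ≤ #{b ∈ U | q b < q a} := by
  refine Finset.card_lt_card (Finset.ssubset_iff_of_subset ?_ |>.2 ⟨j, by simp [hj, hja], by simp⟩)
  intro b hb
  simp only [Finset.mem_filter] at hb ⊢
  exact ⟨hb.1, hb.2.trans hja⟩

open Finset in
-- Descend from `a`: each step lowers the price by at most one and loses at least one cheaper bundle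
-- of `U`.
theorem le_card_below {ι : Type*} {q : ι → ℝ} {U : Finset ι}
    (h : ∀ a, 0 < q a → ∃ j ∈ U, q j < q a ∧ q a ≤ q j + 1) (a : ι) :
    q a ≤ #{b ∈ U | q b < q a} := by
  induction hk : #{b ∈ U | q b < q a} using Nat.strong_induction_on generalizing a with
  | _ k ih =>
    rcases le_or_gt (q a) 0 with h0 | h0
    · exact h0.trans (Nat.cast_nonneg k)
    · obtain ⟨j, hjU, hj, hja⟩ := h a h0
      have h1 := card_filter_lt_succ_le hjU hj
      have h2 := ih _ (by omega) j rfl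
      rw [hk] at h1
      have h3 : ((#{b ∈ U | q b < q j} + 1 : ℕ) : ℝ) ≤ k := by exact_mod_cast h1
      push_cast at h3
      linarith

open Finset in
-- The dearest bundle is bounded by `hm`. For the others, the bounds sum to the number of pairs with
-- distinct prices, hence to at most `(n-1)(n-2)/2`.
theorem sum_le_of_le_card_below (h : ∀ a, q a ≤ #{b | q b < q a}) {s : ι} (hs : ∀ a, q a ≤ q s)
    (hm : q s ≤ (Fintype.card ι : ℝ) - 3 / 2) :
    ∑ a, q a ≤ ((Fintype.card ι : ℝ) ^ 2 - Fintype.card ι - 1) / 2 := by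
  classical
  set E : Finset ι := univ.erase s with hE
  have hcard : (E.card : ℝ) = Fintype.card ι - 1 := by
    rw [hE, card_erase_of_mem (mem_univ s), Nat.cast_sub (by
      rw [Nat.succ_le_iff]; exact card_pos.2 ⟨s, mem_univ s⟩)]
    simp
  have h1 : ∀ a ∈ E, q a ≤ (#{b ∈ E | q b < q a} : ℝ) := by
    intro a _
    refine (h a).trans (le_of_eq ?_)
    congr 2
    ext b
    simp only [hE, mem_filter, mem_univ, true_and, mem_erase, and_true]
    refine ⟨fun hb => ⟨?_, hb⟩, fun hb => hb.2⟩
    rintro rfl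
    exact absurd hb (not_lt.2 (hs a))
  -- Double counting: the pairs can be counted from the dearer or the cheaper end. Adding both
  -- counts, each element meets each other one at most once.
  have h2 : ∑ a ∈ E, #{b ∈ E | q b < q a} = ∑ a ∈ E, #{b ∈ E | q a < q b} :=
    (sum_card_bipartiteAbove_eq_sum_card_bipartiteBelow (s := E) (t := E)
      (fun a b => q b < q a))
  have h3 : ∑ a ∈ E, #{b ∈ E | q b < q a} + ∑ a ∈ E, #{b ∈ E | q a < q b} ≤
      ∑ a ∈ E, (E.card - 1) := by
    rw [← sum_add_distrib]
    refine sum_le_sum fun a ha => ?_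
    rw [← card_union_of_disjoint, ← card_erase_of_mem ha]
    · refine card_le_card fun b hb => ?_
      simp only [mem_union, mem_filter, mem_erase] at hb ⊢
      rcases hb with hb | hb
      · exact ⟨by rintro rfl; exact lt_irrefl _ hb.2, hb.1⟩
      · exact ⟨by rintro rfl; exact lt_irrefl _ hb.2, hb.1⟩
    · refine disjoint_filter.2 fun b _ hb hb' => lt_asymm hb hb'
  have h4 : 2 * ∑ a ∈ E, #{b ∈ E | q b < q a} + E.card ≤ E.card * E.card := by
    rw [sum_const, smul_eq_mul] at h3
    rcases Nat.eq_zero_or_pos E.card with h0 | h0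
    · rw [card_eq_zero] at h0; simp [h0]
    · have : E.card * (E.card - 1) + E.card = E.card * E.card := by
        rw [← Nat.mul_succ]; congr 1; omega
      omega
  have h5 : (2 * ∑ a ∈ E, (#{b ∈ E | q b < q a} : ℝ)) + E.card ≤ E.card * E.card := by
    exact_mod_cast h4
  have h6 := sum_le_sum h1
  rw [← add_sum_erase univ q (mem_univ s), ← hE]
  rw [hcard] at h5
  nlinarith

/-- If no agent envies the bundle `t`, and the agent `t` envies every bundle by at most `1 / 2`,
then the prices are at most `n - 3 / 2`. -/
theorem MinimalPrices.le_of_unenvied (h : MinimalPrices w π q) (hw : EnvyAtMostOne w) {t : ι}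
    (hcard : 2 ≤ Fintype.card ι) (ht : ∀ i, w i t ≤ w i i) (ht' : ∀ a, w t a ≤ w t t + 1 / 2)
    (a : ι) : q a ≤ (Fintype.card ι : ℝ) - 3 / 2 := by
  classical
  have hcardR : (2 : ℝ) ≤ Fintype.card ι := by exact_mod_cast hcard
  have key : ∀ b, q b ≤ (((Finset.univ.erase t).filter fun c => q c < q b).card : ℝ) :=
    le_card_below fun b hb => by
      obtain ⟨j, hj, h1, h2⟩ := h.exists_below_ne hw ht b hb
      exact ⟨j, by simp [hj], h1, h2⟩
  -- Neither `b` nor `t` is counted in `key b`, hence `n - 2`.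
  have key2 : ∀ b, b ≠ t → q b ≤ (Fintype.card ι : ℝ) - 2 := by
    intro b hb
    refine (key b).trans ?_
    have h1 : (Finset.univ.erase t).filter (fun c => q c < q b) ⊆ (Finset.univ.erase t).erase b := by
      intro c hc
      simp only [Finset.mem_filter, Finset.mem_erase] at hc ⊢
      exact ⟨by rintro rfl; exact lt_irrefl _ hc.2, hc.1⟩
    have h2 := Finset.card_le_card h1
    rw [Finset.card_erase_of_mem (by simp [hb]), Finset.card_erase_of_mem (Finset.mem_univ _),
      Finset.card_univ] at h2
    have h3 : (((Finset.univ.erase t).filter fun c => q c < q b).card : ℝ) + 2 ≤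
        Fintype.card ι := by
      exact_mod_cast (by omega)
    linarith
  rcases eq_or_ne a t with rfl | hat
  · rcases le_or_gt (q a) 0 with h0 | h0
    · linarith
    · by_contra! hlt
      -- All other prices are at most `n - 2`, more than `1/2` below, so the agent of the unenvied
      -- bundle would demand nothing else.
      refine h.cut (T := {a}) (S := {a}) (by simp) rfl (by simpa using h0) ?_
      intro i hi b hb
      simp only [Finset.mem_singleton] at hi hb
      subst hi
      exact ⟨i, by linarith [ht' b, key2 b hb]⟩
  · linarith [key2 a hat]

open Finset in
/-- If the largest price exceeds `n - 3 / 2`, then all prices are more than `1 / 2` apart. -/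
theorem MinimalPrices.gap (h : MinimalPrices w π q) (hw : EnvyAtMostOne w) {s : ι}
    (hs : (Fintype.card ι : ℝ) - 3 / 2 < q s) {a b : ι} (hab : a ≠ b)
    (hle : q b ≤ q a) : q b + 1 / 2 < q a := by
  classical
  by_contra! hlt
  -- The descent of `le_card_below`, but never counting `b`. A step onto `b` is redirected to `a`,
  -- which is at least as expensive. If `a` is not below `x`, then `q x ≤ q a ≤ q b + 1/2`, and the
  -- plain bound for `b` suffices.
  have key : ∀ x, q x ≤ (#{c ∈ univ.erase b | q c < q x} : ℝ) + 1 / 2 := by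
    intro x
    induction hk : #{c ∈ univ.erase b | q c < q x} using Nat.strong_induction_on
      generalizing x with
    | _ k ih =>
      have hk0 : (0 : ℝ) ≤ k := Nat.cast_nonneg k
      have step : ∀ j, j ≠ b → q j < q x → q x ≤ q j + 1 → q x ≤ k + 1 / 2 := by
        intro j hjb hj hjx
        have h1 := card_filter_lt_succ_le (U := univ.erase b) (by simp [hjb]) hj
        have h2 := ih _ (by omega) j rfl
        rw [hk] at h1
        have h3 : ((#{c ∈ univ.erase b | q c < q j} + 1 : ℕ) : ℝ) ≤ k := by exact_mod_cast h1
        push_cast at h3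
        linarith
      rcases le_or_gt (q x) 0 with h0 | h0
      · linarith
      obtain ⟨j, hj, hjx⟩ := h.exists_below hw x h0
      rcases eq_or_ne j b with rfl | hjb
      · rcases lt_or_ge (q a) (q x) with hax | hax
        · exact step a hab hax (by linarith)
        · have h1 := le_card_below (U := univ)
            (fun a ha => by simpa using h.exists_below hw a ha) j
          have h2 : #{c | q c < q j} ≤ k := by
            rw [← hk]
            refine card_le_card fun c hc => ?_
            simp only [mem_filter, mem_univ, true_and, mem_erase, and_true] at hc ⊢
            exact ⟨by rintro rfl; exact lt_irrefl _ hc, hc.trans hj⟩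
          have h3 : (#{c | q c < q j} : ℝ) ≤ k := by exact_mod_cast h2
          linarith
      · exact step j hjb hj hjx
  -- With `b` and `x` both uncounted, the bound is `n - 2 + 1/2`, which contradicts `hs`.
  have key2 : ∀ x, x ≠ b → q x ≤ (Fintype.card ι : ℝ) - 3 / 2 := by
    intro x hx
    refine (key x).trans ?_
    have h1 : (univ.erase b).filter (fun c => q c < q x) ⊆ (univ.erase b).erase x := by
      intro c hc
      simp only [mem_filter, mem_erase] at hc ⊢
      exact ⟨by rintro rfl; exact lt_irrefl _ hc.2, hc.1⟩
    have h2 := card_le_card h1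
    rw [card_erase_of_mem (by simp [hx]), card_erase_of_mem (mem_univ _), card_univ] at h2
    have h3 : 2 ≤ Fintype.card ι := by
      exact Fintype.one_lt_card_iff.2 ⟨a, b, hab⟩
    have h4 : (#{c ∈ univ.erase b | q c < q x} : ℝ) + 2 ≤ Fintype.card ι := by
      exact_mod_cast (by omega)
    linarith
  rcases eq_or_ne s b with rfl | hsb
  · linarith [key2 a hab]
  · linarith [key2 s hsb]

/-- Minimal prices that exceed `n - 3 / 2` for the most expensive bundle `s`; the cheapest one is
`t`. -/
structure LargePrices (w : ι → ι → ℝ) (π : Equiv.Perm ι) (q : ι → ℝ) (s t : ι) : Prop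
    extends MinimalPrices w π q where
  envy : EnvyAtMostOne w
  large : (Fintype.card ι : ℝ) - 3 / 2 < q s
  max : ∀ a, q a ≤ q s
  min : ∀ a, q t ≤ q a
  card : 3 ≤ Fintype.card ι

/-! ### Consequences of a price above `n - 3/2` -/

section Large

variable {s t : ι}

theorem LargePrices.eq_zero (h : LargePrices w π q s t) : q t = 0 := by
  by_contra hne
  have h0 : 0 < q t := lt_of_le_of_ne (h.nonneg t) (Ne.symm hne)
  exact h.cut (T := Finset.univ) (S := Finset.univ) ⟨t, Finset.mem_univ t⟩ rfl
    (fun a _ => h0.trans_le (h.min a)) (by simp)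

theorem LargePrices.half_lt (h : LargePrices w π q s t) {a : ι} (ha : a ≠ t) : 1 / 2 < q a := by
  have h1 := h.gap h.envy h.large ha (h.min a)
  have h2 := h.eq_zero
  linarith

/-- The agent `t` of the cheapest bundle demands it. -/
theorem LargePrices.last_demand (h : LargePrices w π q s t) (j : ι) : w t j + q j ≤ w t t := by
  classical
  have h0 := h.eq_zero
  by_contra! hlt
  have hne : (Finset.univ.erase t).Nonempty := by
    rw [← Finset.card_pos, Finset.card_erase_of_mem (Finset.mem_univ t), Finset.card_univ]
    have := h.card
    omega
  obtain ⟨x, hx, hxmin⟩ := Finset.exists_min_image _ q hne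
  have hxt : x ≠ t := (Finset.mem_erase.1 hx).1
  -- The index sets differ: `S` contains the agent `t` in place of the agent `x` of the second
  -- cheapest bundle. The other agents in `S` have prices above `q x + 1/2 > 1`, which exceeds their
  -- envy of the free bundle `t`.
  refine h.cut (T := Finset.univ.erase t) (S := Finset.univ.erase x) hne ?_ ?_ ?_
  · simp [Finset.card_erase_of_mem]
  · intro a ha
    have := h.half_lt (Finset.mem_erase.1 ha).1
    linarith
  · intro i hi b hb
    have hbt : b = t := by simpa using hb
    have hix : i ≠ x := (Finset.mem_erase.1 hi).1
    subst hbt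
    rcases eq_or_ne i b with rfl | hib
    · exact ⟨j, by linarith⟩
    · refine ⟨i, ?_⟩
      have h1 := h.gap h.envy h.large hix (hxmin i (by simp [hib]))
      have h2 := h.half_lt hxt
      linarith [h.envy i b]

/-- Nobody envies the agent `s` of the most expensive bundle. -/
theorem LargePrices.first_unenvied (h : LargePrices w π q s t) (i : ι) : w i s ≤ w i i := by
  classical
  have h0 := h.eq_zero
  rcases eq_or_ne i s with rfl | his
  · exact le_rfl
  rcases eq_or_ne i t with rfl | hit
  · linarith [h.last_demand s, h.nonneg s]
  by_contra! hlt
  have hqi := h.half_lt hit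
  -- Two gaps of `1/2`, one on either side of `q i`, outweigh envy of one. The agent `i` itself
  -- refuses the bundles below `q i` because it prefers `s`.
  have hfar : ∀ x b, x ≠ i → q i ≤ q x → q b < q i → q b + 1 < q x := by
    intro x b hx hix hbi
    have h1 := h.gap h.envy h.large hx hix
    have h2 := h.gap h.envy h.large (a := i) (b := b) (by rintro rfl; exact lt_irrefl _ hbi) hbi.le
    linarith
  refine h.cut (T := {b | q i ≤ q b}) (S := {b | q i ≤ q b}) ⟨i, by simp⟩ rfl ?_ ?_
  · intro b hb
    simp only [Finset.mem_filter, Finset.mem_univ, true_and] at hb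
    linarith
  · intro x hx b hb
    simp only [Finset.mem_filter, Finset.mem_univ, true_and, not_le] at hx hb
    rcases eq_or_ne x i with rfl | hxi
    · exact ⟨s, by linarith [hfar s b his.symm (h.max x) hb, h.envy x b]⟩
    · exact ⟨x, by linarith [hfar x b hxi hx hb, h.envy x b]⟩

/-- Somebody envies the agent `t` of the cheapest bundle. -/
theorem LargePrices.last_envied (h : LargePrices w π q s t) : ∃ i, w i i < w i t := by
  classical
  by_contra! hno
  have h0 := h.eq_zero
  have hpos : ∀ a, a ≠ t → 0 < q a := fun a ha => by
    linarith [h.half_lt ha]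
  -- If nobody envied the free bundle `t`, every other agent would strictly prefer its own bundle,
  -- whose price is positive.
  refine h.cut (T := Finset.univ.erase t) (S := Finset.univ.erase t) ?_ rfl ?_ ?_
  · rw [← Finset.card_pos, Finset.card_erase_of_mem (Finset.mem_univ t), Finset.card_univ]
    have := h.card
    omega
  · exact fun a ha => hpos a (Finset.mem_erase.1 ha).1
  · intro i hi b hb
    have hbt : b = t := by simpa using hb
    subst hbt
    exact ⟨i, by linarith [hno i, hpos i (Finset.mem_erase.1 hi).1]⟩

end Large

end Prices

/-! ### Program fragments -/

/-! ### Rewriting rules for memory updates -/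

section Store

variable (s : Store) (x y k a i j a' i' j' : ℕ) (r : ℝ)

@[simp] theorem Store.nvar_setN : (s.setN x k).nvar y = if y = x then k else s.nvar y := rfl
@[simp] theorem Store.rvar_setN : (s.setN x k).rvar = s.rvar := rfl
@[simp] theorem Store.narr_setN : (s.setN x k).narr = s.narr := rfl
@[simp] theorem Store.rarr_setN : (s.setN x k).rarr = s.rarr := rfl
@[simp] theorem Store.nvar_setR : (s.setR x r).nvar = s.nvar := rfl
@[simp] theorem Store.rvar_setR : (s.setR x r).rvar y = if y = x then r else s.rvar y := rfl
@[simp] theorem Store.narr_setR : (s.setR x r).narr = s.narr := rfl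
@[simp] theorem Store.rarr_setR : (s.setR x r).rarr = s.rarr := rfl
@[simp] theorem Store.nvar_storeN : (s.storeN a i j k).nvar = s.nvar := rfl
@[simp] theorem Store.rvar_storeN : (s.storeN a i j k).rvar = s.rvar := rfl
@[simp] theorem Store.narr_storeN : (s.storeN a i j k).narr a' i' j' =
    if a' = a ∧ i' = i ∧ j' = j then k else s.narr a' i' j' := rfl
@[simp] theorem Store.rarr_storeN : (s.storeN a i j k).rarr = s.rarr := rfl
@[simp] theorem Store.nvar_storeR : (s.storeR a i j r).nvar = s.nvar := rfl
@[simp] theorem Store.rvar_storeR : (s.storeR a i j r).rvar = s.rvar := rfl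
@[simp] theorem Store.narr_storeR : (s.storeR a i j r).narr = s.narr := rfl
@[simp] theorem Store.rarr_storeR : (s.storeR a i j r).rarr a' i' j' =
    if a' = a ∧ i' = i ∧ j' = j then r else s.rarr a' i' j' := rfl

end Store

-- Memory layout. Natural arrays: `1` bundles, `2` bundle of each agent, `3` holder of each bundle,
-- `4` ranks, `5` parents, `6` last item of each bundle. Real arrays: `1` values, `2` prices. The
-- real scalar `1` is the penalty. Arrays `0` hold the output.
attribute [simp] NExp.eval RExp.eval Program.nvars Program.rvars Program.narrs Program.rarrs

/-- Find an index `x < e` that satisfies the test `g` and maximizes `f`, where `g` and `f` may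
depend on `x`, the natural scalar `2`.  The index is stored in the natural scalar `6`, and the
maximum in the real scalar `0`. -/
def argmaxP (e : NExp) (g : Test) (f : RExp) : Program :=
  .seq (.setN 7 (.lit 0)) (.forTo 2 e
    (.cond (.and g (.or (.nle (.var 7) (.lit 0)) (.rle (.var 0) f)))
      (.seq (.setN 6 (.var 2)) (.seq (.setR 0 f) (.setN 7 (.lit 1)))) .skip))

/-- The natural scalar `7` records whether a candidate has been seen, so no initial lower bound for
`F` is needed. -/
theorem runs_argmaxP {e : NExp} {g : Test} {f : RExp} {s : Store} (N : ℕ) (G : ℕ → Prop)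
    (F : ℕ → ℝ) (hN : N ≤ K) (he : ∀ s', Framed (argmaxP e g f) s s' → e.eval s' = N)
    (hg : ∀ s', Framed (argmaxP e g f) s s' → (g.Holds s' ↔ G (s'.nvar 2)))
    (hf : ∀ s', Framed (argmaxP e g f) s s' → f.eval s' = F (s'.nvar 2))
    (hex : ∃ a < N, G a) :
    Runs v K (argmaxP e g f) s fun s' => s'.nvar 6 < N ∧ G (s'.nvar 6) ∧
      s'.rvar 0 = F (s'.nvar 6) ∧ ∀ a < N, G a → F a ≤ F (s'.nvar 6) := by
  have hfr : ∀ s', Framed (.forTo 2 e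
      (.cond (.and g (.or (.nle (.var 7) (.lit 0)) (.rle (.var 0) f)))
      (.seq (.setN 6 (.var 2)) (.seq (.setR 0 f) (.setN 7 (.lit 1)))) .skip)) (s.setN 7 0) s' →
      Framed (argmaxP e g f) s s' := fun s' h =>
    (Framed.setN s 7 0 (by simp [argmaxP])).trans
      (h.mono (by simp [argmaxP]) (by simp [argmaxP])
        (by simp [argmaxP]) (by simp [argmaxP]))
  refine Runs.seq (Runs.setN ?_)
  refine (Runs.forTo N (fun k s' => (s'.nvar 7 = 0 → ∀ a < k, ¬ G a) ∧ (s'.nvar 7 ≠ 0 →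
    s'.nvar 6 < k ∧ G (s'.nvar 6) ∧ s'.rvar 0 = F (s'.nvar 6) ∧
      ∀ a < k, G a → F a ≤ F (s'.nvar 6))) (by simp) hN (fun s' h => he s' (hfr s' h))
    (by simp) ?_).mono ?_
  · rintro k s' hk rfl hfr' ⟨h1, h2⟩
    have hF := hf s' (hfr s' hfr')
    have hG := hg s' (hfr s' hfr')
    refine Runs.cond (fun hb => ?_) (fun hb => ?_)
    · refine Runs.seq (Runs.setN (Runs.seq (Runs.setR (Runs.setN ?_))))
      simp only [Test.Holds, Test.holds_or, NExp.eval, RExp.eval, hG, hF] at hb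
      have hF' : f.eval (s'.setN 6 (s'.nvar 2)) = F (s'.nvar 2) := by
        refine (hf _ ((hfr s' hfr').trans (Framed.setN _ _ _ ?_))).trans (by simp)
        simp [argmaxP]
      simp only [NExp.eval, Store.nvar_setN, Store.nvar_setR, Store.rvar_setN, Store.rvar_setR, hF']
      simp only [Nat.reduceEqDiff, if_true, if_false, one_ne_zero, ne_eq, not_false_eq_true,
        forall_const, false_implies, true_and]
      refine ⟨Nat.lt_succ_self _, hb.1, ?_⟩
      intro a ha hGa
      rcases Nat.lt_succ_iff_lt_or_eq.1 ha with ha | rfl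
      · by_cases h7 : s'.nvar 7 = 0
        · exact absurd hGa (h1 h7 a ha)
        · obtain ⟨-, -, h3, h4⟩ := h2 h7
          refine (h4 a ha hGa).trans ?_
          rw [← h3]
          exact hb.2.resolve_left (by omega)
      · exact le_rfl
    · refine Runs.skip ?_
      simp only [Test.Holds, Test.holds_or, NExp.eval, RExp.eval, hG, hF] at hb
      simp only [Store.nvar_setN, Store.rvar_setN]
      simp only [Nat.reduceEqDiff, if_false]
      refine ⟨fun h7 a ha hGa => ?_, fun h7 => ?_⟩
      · rcases Nat.lt_succ_iff_lt_or_eq.1 ha with ha | rfl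
        · exact h1 h7 a ha hGa
        · exact hb ⟨hGa, Or.inl h7.le⟩
      · obtain ⟨h3, h4, h5, h6⟩ := h2 h7
        refine ⟨by omega, h4, h5, fun a ha hGa => ?_⟩
        rcases Nat.lt_succ_iff_lt_or_eq.1 ha with ha | rfl
        · exact h6 a ha hGa
        · by_contra hlt
          exact hb ⟨hGa, Or.inr (by rw [h5]; exact (not_le.1 hlt).le)⟩
  · rintro s' - ⟨-, h1, h2⟩
    obtain ⟨a, ha, hGa⟩ := hex
    exact h2 fun h7 => h1 h7 a ha hGa

/-- For `x < e`, where `x` is the natural scalar `2`, assign `f` to the entry `(0, x)` of the real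
array `A` if the test `g` holds. -/
def mapR (A : ℕ) (e : NExp) (g : Test) (f : RExp) : Program :=
  .forTo 2 e (.cond g (.storeR A (.lit 0) (.var 2) f) .skip)

/-- For `x < e`, where `x` is the natural scalar `2`, assign `f` to the entry `(0, x)` of the
natural array `A` if the test `g` holds. -/
def mapN (A : ℕ) (e : NExp) (g : Test) (f : NExp) : Program :=
  .forTo 2 e (.cond g (.storeN A (.lit 0) (.var 2) f) .skip)

open Classical in
-- The test and the new value may read the array that is being written, at the current index: that
-- entry is still the original one, which is the last premise of `hgf`.
theorem runs_mapR {A : ℕ} {e : NExp} {g : Test} {f : RExp} {s : Store} (N : ℕ) (G : ℕ → Prop)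
    (F : ℕ → ℝ) (hN : N ≤ K) (he : ∀ s', Framed (mapR A e g f) s s' → e.eval s' = N)
    (hgf : ∀ s', Framed (mapR A e g f) s s' → s'.nvar 2 < N →
      s'.rarr A 0 (s'.nvar 2) = s.rarr A 0 (s'.nvar 2) →
      (g.Holds s' ↔ G (s'.nvar 2)) ∧ f.eval s' = F (s'.nvar 2)) :
    Runs v K (mapR A e g f) s fun s' =>
      ∀ a, s'.rarr A 0 a = if a < N ∧ G a then F a else s.rarr A 0 a := by
  refine (Runs.forTo N (fun k s' => ∀ a, s'.rarr A 0 a =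
    if a < k ∧ G a then F a else s.rarr A 0 a) (by simp) hN he (by simp) ?_).mono
    fun s' _ h => h.2
  rintro k s' hk rfl hfr hI
  obtain ⟨hG, hF⟩ := hgf s' hfr hk (by simp [hI])
  refine Runs.cond (fun hb => Runs.storeR fun a => ?_) (fun hb => Runs.skip fun a => ?_)
  · rw [hG] at hb
    by_cases ha : a = s'.nvar 2
    · simp [ha, hb, hF]
    · simp [ha, hI, Nat.le_iff_lt_or_eq]
  · rw [hG] at hb
    by_cases ha : a = s'.nvar 2
    · simp [ha, hb, hI]
    · simp [ha, hI, Nat.le_iff_lt_or_eq]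

open Classical in
theorem runs_mapN {A : ℕ} {e : NExp} {g : Test} {f : NExp} {s : Store} (N : ℕ) (G : ℕ → Prop)
    (F : ℕ → ℕ) (hN : N ≤ K) (he : ∀ s', Framed (mapN A e g f) s s' → e.eval s' = N)
    (hgf : ∀ s', Framed (mapN A e g f) s s' → s'.nvar 2 < N →
      s'.narr A 0 (s'.nvar 2) = s.narr A 0 (s'.nvar 2) →
      (g.Holds s' ↔ G (s'.nvar 2)) ∧ f.eval s' = F (s'.nvar 2)) :
    Runs v K (mapN A e g f) s fun s' =>
      ∀ a, s'.narr A 0 a = if a < N ∧ G a then F a else s.narr A 0 a := by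
  refine (Runs.forTo N (fun k s' => ∀ a, s'.narr A 0 a =
    if a < k ∧ G a then F a else s.narr A 0 a) (by simp) hN he (by simp) ?_).mono
    fun s' _ h => h.2
  rintro k s' hk rfl hfr hI
  obtain ⟨hG, hF⟩ := hgf s' hfr hk (by simp [hI])
  refine Runs.cond (fun hb => Runs.storeN fun a => ?_) (fun hb => Runs.skip fun a => ?_)
  · rw [hG] at hb
    by_cases ha : a = s'.nvar 2
    · simp [ha, hb, hF]
    · simp [ha, hI, Nat.le_iff_lt_or_eq]
  · rw [hG] at hb
    by_cases ha : a = s'.nvar 2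
    · simp [ha, hb, hI]
    · simp [ha, hI, Nat.le_iff_lt_or_eq]

/-- The test that always succeeds. -/
def Test.true : Test := .nle (.lit 0) (.lit 0)

@[simp] theorem Test.holds_true {s : Store} : Test.true.Holds s := le_rfl (a := 0)

/-! ### Growing a tree of tight envy -/

/-- How much less the holder of the bundle `a` likes the bundle `b` than the bundle `a` at the
prices `y`, where `h` maps bundles to their holders. -/
def slack (W : ℕ → ℕ → ℝ) (h : ℕ → ℕ) (y : ℕ → ℝ) (a b : ℕ) : ℝ :=
  (y a + W (h a) a) - (y b + W (h a) b)

/-- After `k` rounds, `rk` numbers the `k + 1` bundles that are in the tree with root `c`, and `nx`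
maps them to their parents; for the other bundles, `nx` is the best potential parent. -/
structure GrowInv (W : ℕ → ℕ → ℝ) (h : ℕ → ℕ) (N c k : ℕ) (y : ℕ → ℝ) (rk nx : ℕ → ℕ) :
    Prop where
  card : ((Finset.range N).filter fun a => rk a ≠ 0).card = k + 1
  root : rk c = 1
  rk_le : ∀ a < N, rk a ≤ k + 1
  nx_lt : ∀ a < N, nx a < N
  nx_pos : ∀ a < N, rk (nx a) ≠ 0
  rk_nx : ∀ a < N, a ≠ c → rk a ≠ 0 → rk (nx a) < rk a
  tight : ∀ a < N, a ≠ c → rk a ≠ 0 → slack W h y a (nx a) = 0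
  best : ∀ a < N, rk a = 0 → ∀ b < N, rk b ≠ 0 → slack W h y a (nx a) ≤ slack W h y a b
  -- The root is exempt: its holder, if any, need not demand it.
  nonneg : ∀ a < N, a ≠ c → ∀ b < N, 0 ≤ slack W h y a b

theorem GrowInv.init {W : ℕ → ℕ → ℝ} {h : ℕ → ℕ} {N c : ℕ} {y : ℕ → ℝ} {rk nx : ℕ → ℕ}
    (hc : c < N) (hrk : ∀ a < N, rk a = if a = c then 1 else 0) (hnx : ∀ a < N, nx a = c)
    (hy : ∀ a < N, a ≠ c → ∀ b < N, 0 ≤ slack W h y a b) : GrowInv W h N c 0 y rk nx where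
  card := by
    rw [zero_add, Finset.card_eq_one]
    refine ⟨c, ?_⟩
    ext a
    simp only [Finset.mem_filter, Finset.mem_range, Finset.mem_singleton]
    constructor
    · rintro ⟨ha, h0⟩
      rw [hrk a ha] at h0
      by_contra hne
      simp [hne] at h0
    · rintro rfl
      exact ⟨hc, by simp [hrk a hc]⟩
  root := by simp [hrk c hc]
  rk_le a ha := by rw [hrk a ha]; split_ifs <;> simp
  nx_lt a ha := by rw [hnx a ha]; exact hc
  nx_pos a ha := by rw [hnx a ha, hrk c hc]; simp
  rk_nx a ha hac h0 := by rw [hrk a ha, if_neg hac] at h0; exact absurd rfl h0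
  tight a ha hac h0 := by rw [hrk a ha, if_neg hac] at h0; exact absurd rfl h0
  best a ha h0 b hb hb0 := by
    rw [hrk b hb] at hb0
    have : b = c := by by_contra hne; simp [hne] at hb0
    rw [hnx a ha, this]
  nonneg := hy

/-- Lower all prices outside the tree by the least slack `δ` towards the tree. Slacks within either
side are unchanged, those from the tree outwards grow, and those into the tree shrink by `δ`, which
the minimality of `δ` permits. The edge from `x` to its parent becomes tight. Ranks so far are at
most `k + 1`, so `x` gets `k + 2`. -/
theorem GrowInv.step {W : ℕ → ℕ → ℝ} {h : ℕ → ℕ} {N c k : ℕ} {y y' : ℕ → ℝ}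
    {rk nx rk' nx' : ℕ → ℕ} (H : GrowInv W h N c k y rk nx) (hc : c < N) {x : ℕ} (hx : x < N)
    (hx0 : rk x = 0)
    (hmin : ∀ a < N, rk a = 0 → slack W h y x (nx x) ≤ slack W h y a (nx a))
    (hy : ∀ a, a < N → y' a = if rk a = 0 then y a - slack W h y x (nx x) else y a)
    (hrk : ∀ a, a < N → rk' a = if a = x then k + 2 else rk a)
    (hnx : ∀ a, a < N → nx' a =
      if rk' a = 0 ∧ slack W h y' a x ≤ slack W h y' a (nx a) then x else nx a) :
    GrowInv W h N c (k + 1) y' rk' nx' := by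
  set δ := slack W h y x (nx x) with hδ
  have hxc : x ≠ c := by rintro rfl; simp [H.root] at hx0
  have hδ0 : 0 ≤ δ := H.nonneg x hx hxc _ (H.nx_lt x hx)
  have hsl : ∀ a b, slack W h y' a b = slack W h y a b + (y' a - y a) - (y' b - y b) := by
    intro a b; simp only [slack]; ring
  have hin : ∀ a, a < N → rk a ≠ 0 → y' a = y a := fun a ha h0 => by rw [hy a ha, if_neg h0]
  have hout : ∀ a, a < N → rk a = 0 → y' a = y a - δ := fun a ha h0 => by rw [hy a ha, if_pos h0]
  have hrkx : rk' x = k + 2 := by rw [hrk x hx, if_pos rfl]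
  have hrkne : ∀ a, a < N → a ≠ x → rk' a = rk a := fun a ha hax => by rw [hrk a ha, if_neg hax]
  have hpos : ∀ a, a < N → rk a ≠ 0 → rk' a ≠ 0 := fun a ha h0 => by
    rw [hrk a ha]; split_ifs <;> omega
  have hnx_in : ∀ a, a < N → rk' a ≠ 0 → nx' a = nx a := fun a ha h0 => by
    rw [hnx a ha, if_neg fun h => h0 h.1]
  have hnxr : ∀ a, a < N → rk' (nx a) = rk (nx a) := fun a ha =>
    hrkne _ (H.nx_lt a ha) fun h => H.nx_pos a ha (h ▸ hx0)
  refine ⟨?_, ?_, ?_, ?_, ?_, ?_, ?_, ?_, ?_⟩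
  · have : (Finset.range N).filter (fun a => rk' a ≠ 0) =
        insert x ((Finset.range N).filter fun a => rk a ≠ 0) := by
      ext a
      simp only [Finset.mem_filter, Finset.mem_range, Finset.mem_insert]
      constructor
      · rintro ⟨ha, h0⟩
        by_cases hax : a = x
        · exact Or.inl hax
        · exact Or.inr ⟨ha, by rwa [hrkne a ha hax] at h0⟩
      · rintro (rfl | ⟨ha, h0⟩)
        · exact ⟨hx, by omega⟩
        · exact ⟨ha, hpos a ha h0⟩
    rw [this, Finset.card_insert_of_notMem (by simp [hx0]), H.card]
  · rw [hrkne c hc hxc.symm, H.root]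
  · intro a ha
    rw [hrk a ha]
    have := H.rk_le a ha
    split_ifs <;> omega
  · intro a ha
    rw [hnx a ha]
    split_ifs
    · exact hx
    · exact H.nx_lt a ha
  · intro a ha
    rw [hnx a ha]
    split_ifs
    · omega
    · exact hpos _ (H.nx_lt a ha) (H.nx_pos a ha)
  · intro a ha hac h0
    rw [hnx_in a ha h0, hnxr a ha]
    by_cases hax : a = x
    · have := H.rk_le (nx a) (H.nx_lt a ha)
      rw [hax, hrkx]; rw [hax] at this; omega
    · rw [hrkne a ha hax] at h0 ⊢
      exact H.rk_nx a ha hac h0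
  · intro a ha hac h0
    rw [hnx_in a ha h0, hsl, hin _ (H.nx_lt a ha) (H.nx_pos a ha)]
    by_cases hax : a = x
    · rw [hax, hout x hx hx0, ← hδ]; ring
    · rw [hrkne a ha hax] at h0
      rw [hin a ha h0, H.tight a ha hac h0]; ring
  · intro a ha h0 b hb hb0
    have hax : a ≠ x := by rintro rfl; omega
    have h0' : rk a = 0 := by rwa [hrkne a ha hax] at h0
    have hbest : ∀ b < N, rk b ≠ 0 → slack W h y' a (nx a) ≤ slack W h y' a b := by
      intro b hb hb0
      rw [hsl, hsl, hin _ (H.nx_lt a ha) (H.nx_pos a ha), hin b hb hb0]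
      linarith [H.best a ha h0' b hb hb0]
    rw [hnx a ha]
    by_cases hbx : b = x
    · rw [hbx]
      split_ifs with hif
      · exact le_rfl
      · exact (not_le.1 fun h => hif ⟨h0, h⟩).le
    · have := hbest b hb (by rwa [hrkne b hb hbx] at hb0)
      split_ifs with hif
      · exact hif.2.trans this
      · exact this
  · intro a ha hac b hb
    have h1 := H.nonneg a ha hac b hb
    rw [hsl]
    by_cases ha0 : rk a = 0 <;> by_cases hb0 : rk b = 0
    · rw [hout a ha ha0, hout b hb hb0]; linarith
    · rw [hout a ha ha0, hin b hb hb0]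
      linarith [H.best a ha ha0 b hb hb0, hmin a ha ha0]
    · rw [hin a ha ha0, hout b hb hb0]; linarith
    · rw [hin a ha ha0, hin b hb hb0]; linarith

/-- the price of the bundle `i` -/
def priceE (i : NExp) : RExp := .arr 2 (.lit 0) i

/-- the holder of the bundle `i` -/
def holderE (i : NExp) : NExp := .arr 3 (.lit 0) i

/-- the number of the bundle `i` in the tree -/
def rankE (i : NExp) : NExp := .arr 4 (.lit 0) i

/-- the parent of the bundle `i` in the tree -/
def parentE (i : NExp) : NExp := .arr 5 (.lit 0) i

/-- the negative of the slack from the bundle `i` to the bundle `j` -/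
def negSlackE (i j : NExp) : RExp :=
  .sub (.add (priceE j) (.arr 1 (holderE i) j)) (.add (priceE i) (.arr 1 (holderE i) i))

/-- The bundle `x` is not in the tree. -/
def outsideT : Test := .neq (rankE (.var 2)) (.lit 0)

/-- One round of `growP`. -/
def growStepP : Program :=
  .seq (argmaxP (.var 8) outsideT (negSlackE (.var 2) (parentE (.var 2)))) <|
  .seq (mapR 2 (.var 8) outsideT (.add (priceE (.var 2)) (.var 0))) <|
  .seq (.storeN 4 (.lit 0) (.var 6) (.add (.var 4) (.lit 2))) <|
  mapN 5 (.var 8) (.and outsideT (.rle (negSlackE (.var 2) (parentE (.var 2)))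
    (negSlackE (.var 2) (.var 6)))) (.var 6)

/-- Grow a tree of tight envy towards the bundle that is given by the natural scalar `5`, while
decreasing the prices of the other bundles.  The number of bundles is the natural scalar `8`. -/
def growP : Program :=
  .seq (mapN 4 (.var 8) .true (.lit 0)) <|
  .seq (mapN 5 (.var 8) .true (.var 5)) <|
  .seq (.storeN 4 (.lit 0) (.var 5) (.lit 1)) <|
  .forTo 4 (.sub (.var 8) (.lit 1)) growStepP

theorem eval_negSlackE (s : Store) (i j : NExp) : (negSlackE i j).eval s =
    -slack (s.rarr 1) (s.narr 3 0) (s.rarr 2 0) (i.eval s) (j.eval s) := by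
  simp [negSlackE, slack, priceE, holderE]

theorem runs_growStepP {W : ℕ → ℕ → ℝ} {h : ℕ → ℕ} {N c k : ℕ} {s : Store} (hN : N ≤ K)
    (hc : c < N) (hk : k + 1 < N) (hsN : s.nvar 8 = N) (hsk : s.nvar 4 = k) (hW : s.rarr 1 = W)
    (hh : s.narr 3 0 = h) (H : GrowInv W h N c k (s.rarr 2 0) (s.narr 4 0) (s.narr 5 0)) :
    Runs v K growStepP s fun s' =>
      GrowInv W h N c (k + 1) (s'.rarr 2 0) (s'.narr 4 0) (s'.narr 5 0) := by
  subst hW hh hsN hsk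
  -- The tree has `k + 1 < N` bundles, so some bundle is outside it.
  have hex : ∃ a < s.nvar 8, s.narr 4 0 a = 0 := by
    by_contra! hno
    have h1 := H.card
    rw [Finset.filter_true_of_mem (fun a ha => hno a (Finset.mem_range.1 ha)),
      Finset.card_range] at h1
    omega
  refine Runs.seq' (runs_argmaxP (s.nvar 8) (fun a => s.narr 4 0 a = 0)
    (fun a => -slack (s.rarr 1) (s.narr 3 0) (s.rarr 2 0) a (s.narr 5 0 a)) hN
    (fun s' hf => hf.nvar 8 (by simp [argmaxP])) (fun s' hf => ?_) (fun s' hf => ?_) hex)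
    fun s1 hf1 ⟨hx, hx0, hr, hmin⟩ => ?_
  · simp [outsideT, rankE, hf.narr 4 (by simp [argmaxP])]
  · rw [eval_negSlackE, hf.rarr 1 (by simp [argmaxP]), hf.rarr 2 (by simp [argmaxP]),
      hf.narr 3 (by simp [argmaxP])]
    simp [parentE, hf.narr 5 (by simp [argmaxP])]
  have e8 := hf1.nvar 8 (by simp [argmaxP])
  have e4 := hf1.nvar 4 (by simp [argmaxP])
  have w1 := hf1.rarr 1 (by simp [argmaxP])
  have w2 := hf1.rarr 2 (by simp [argmaxP])
  have a3 := hf1.narr 3 (by simp [argmaxP])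
  have a4 := hf1.narr 4 (by simp [argmaxP])
  have a5 := hf1.narr 5 (by simp [argmaxP])
  -- The real scalar `0` holds the maximum of the negated slacks, that is `-δ`, so adding it lowers
  -- the prices.
  refine Runs.seq' (runs_mapR (s.nvar 8) (fun a => s.narr 4 0 a = 0)
    (fun a => s.rarr 2 0 a + s1.rvar 0) hN
    (fun s' hf => by simpa [e8] using hf.nvar 8 (by simp [mapR])) (fun s' hf hlt hown => ⟨?_, ?_⟩))
    fun s2 hf2 hy => ?_
  · simp [outsideT, rankE, hf.narr 4 (by simp [mapR]), a4]
  · simp [priceE, hown, w2, hf.rvar 0 (by simp [mapR])]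
  refine Runs.seq (Runs.storeN ?_)
  set s3 := s2.storeN 4 ((NExp.lit 0).eval s2) ((NExp.var 6).eval s2)
    ((NExp.add (.var 4) (.lit 2)).eval s2) with hs3
  have f8 : s3.nvar 8 = s.nvar 8 := (hf2.nvar 8 (by simp [mapR])).trans e8
  have f6 : s3.nvar 6 = s1.nvar 6 := hf2.nvar 6 (by simp [mapR])
  have f4 : s2.nvar 4 = s.nvar 4 := (hf2.nvar 4 (by simp [mapR])).trans e4
  have x1 : s3.rarr 1 = s.rarr 1 := (hf2.rarr 1 (by simp [mapR])).trans w1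
  have b3 : s3.narr 3 = s.narr 3 := by
    funext i j
    simp [hs3, hf2.narr 3 (by simp [mapR]), a3]
  have b5 : s3.narr 5 = s.narr 5 := by
    funext i j
    simp [hs3, hf2.narr 5 (by simp [mapR]), a5]
  have b4 : ∀ a, s3.narr 4 0 a = if a = s1.nvar 6 then s.nvar 4 + 2 else s.narr 4 0 a := by
    intro a
    simp [hs3, hf2.nvar 6 (by simp [mapR]), f4, hf2.narr 4 (by simp [mapR]), a4]
  refine (runs_mapN (s.nvar 8) (fun a => s3.narr 4 0 a = 0 ∧
    slack (s.rarr 1) (s.narr 3 0) (s3.rarr 2 0) a (s1.nvar 6) ≤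
      slack (s.rarr 1) (s.narr 3 0) (s3.rarr 2 0) a (s.narr 5 0 a)) (fun _ => s1.nvar 6) hN
    (fun s' hf => by simpa [f8] using hf.nvar 8 (by simp [mapN])) (fun s' hf hlt hown => ⟨?_, ?_⟩)).mono
    fun s4 hf4 hnx => ?_
  · simp only [Test.Holds, outsideT, rankE, Test.holds_neq, eval_negSlackE, NExp.eval,
      parentE, hown, b5, hf.narr 4 (by simp [mapN]), hf.rarr 1 (by simp [mapN]),
      hf.rarr 2 (by simp [mapN]), hf.narr 3 (by simp [mapN]), hf.nvar 6 (by simp [mapN]), x1, b3, f6]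
    exact and_congr_right fun _ => neg_le_neg_iff
  · simp [hf.nvar 6 (by simp [mapN]), f6]
  · have c4 : s4.narr 4 = s3.narr 4 := hf4.narr 4 (by simp [mapN])
    have c2 : s4.rarr 2 = s3.rarr 2 := hf4.rarr 2 (by simp [mapN])
    rw [c4, c2]
    refine H.step hc hx hx0 (fun a ha h0 => neg_le_neg_iff.1 (hmin a ha h0)) (fun a ha => ?_)
      (fun a _ => b4 a) (fun a ha => ?_)
    · have : s3.rarr 2 0 a = s2.rarr 2 0 a := rfl
      rw [this, hy a, hr, w2]
      simp [ha, sub_eq_add_neg]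
    · rw [hnx a, b5]
      simp [ha]

theorem runs_growP {W : ℕ → ℕ → ℝ} {h : ℕ → ℕ} {N c : ℕ} {s : Store} (hN : N ≤ K)
    (hc : c < N) (hsN : s.nvar 8 = N) (hsc : s.nvar 5 = c) (hW : s.rarr 1 = W)
    (hh : s.narr 3 0 = h) (hy : ∀ a < N, a ≠ c → ∀ b < N, 0 ≤ slack W h (s.rarr 2 0) a b) :
    Runs v K growP s fun s' =>
      GrowInv W h N c (N - 1) (s'.rarr 2 0) (s'.narr 4 0) (s'.narr 5 0) := by
  subst hW hh hsN hsc
  refine Runs.seq' (runs_mapN (s.nvar 8) (fun _ => True) (fun _ => 0) hN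
    (fun s' hf => hf.nvar 8 (by simp [mapN])) (fun s' hf hlt hown => by simp)) fun s1 hf1 h1 => ?_
  have e8 := hf1.nvar 8 (by simp [mapN])
  have e5 := hf1.nvar 5 (by simp [mapN])
  refine Runs.seq' (runs_mapN (s.nvar 8) (fun _ => True) (fun _ => s.nvar 5) hN
    (fun s' hf => by simpa [e8] using hf.nvar 8 (by simp [mapN]))
    (fun s' hf hlt hown => by simp [hf.nvar 5 (by simp [mapN]), e5])) fun s2 hf2 h2 => ?_
  refine Runs.seq (Runs.storeN ?_)
  have f8 : s2.nvar 8 = s.nvar 8 := (hf2.nvar 8 (by simp [mapN])).trans e8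
  have f5 : s2.nvar 5 = s.nvar 5 := (hf2.nvar 5 (by simp [mapN])).trans e5
  have x1 : s2.rarr 1 = s.rarr 1 :=
    (hf2.rarr 1 (by simp [mapN])).trans (hf1.rarr 1 (by simp [mapN]))
  have x2 : s2.rarr 2 = s.rarr 2 :=
    (hf2.rarr 2 (by simp [mapN])).trans (hf1.rarr 2 (by simp [mapN]))
  have b3 : s2.narr 3 = s.narr 3 :=
    (hf2.narr 3 (by simp [mapN])).trans (hf1.narr 3 (by simp [mapN]))
  have b4 : s2.narr 4 = s1.narr 4 := hf2.narr 4 (by simp [mapN])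
  set s3 := s2.storeN 4 ((NExp.lit 0).eval s2) ((NExp.var 5).eval s2) ((NExp.lit 1).eval s2)
    with hs3
  have g3 : s3.narr 3 = s.narr 3 := by
    funext i j
    simp [hs3, b3]
  refine (Runs.forTo (s.nvar 8 - 1) (fun k s' => GrowInv (s.rarr 1) (s.narr 3 0) (s.nvar 8)
    (s.nvar 5) k (s'.rarr 2 0) (s'.narr 4 0) (s'.narr 5 0)) (by decide) (by omega)
    (fun s' hf => ?_) ?_ ?_).mono fun s' _ h => h.2
  · simp only [NExp.eval]
    rw [hf.nvar 8 (by decide)]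
    simp [hs3, f8]
  · refine GrowInv.init hc (fun a ha => ?_) (fun a ha => ?_) ?_
    · simp [hs3, f5, b4, h1, ha]
    · simp [hs3, h2, ha]
    · simpa [hs3, x2] using hy
  · intro k s' hk hsk hf H
    refine (runs_growStepP hN hc (by omega) ?_ hsk ?_ ?_ H).mono fun s'' _ H' => by simpa using H'
    · rw [hf.nvar 8 (by decide)]; exact f8
    · rw [hf.rarr 1 (by decide)]; exact x1
    · rw [hf.narr 3 (by decide), g3]

/-! ### Optimal assignments of bundles -/

/-- The function `h` permutes the natural numbers below `N`. -/
structure IsPermOn (N : ℕ) (h : ℕ → ℕ) : Prop where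
  lt : ∀ a < N, h a < N
  inj : ∀ a < N, ∀ b < N, h a = h b → a = b

theorem IsPermOn.swap {N : ℕ} {h h' : ℕ → ℕ} (H : IsPermOn N h) {c x : ℕ} (hc : c < N) (hx : x < N)
    (hh : ∀ a, h' a = if a = c then h x else if a = x then h c else h a) : IsPermOn N h' := by
  have e : ∀ a, h' a = h (if a = c then x else if a = x then c else a) := by
    intro a; rw [hh]; split_ifs <;> rfl
  refine ⟨fun a ha => ?_, fun a ha b hb hab => ?_⟩
  · rw [e]; refine H.lt _ ?_; split_ifs <;> assumption
  · rw [e, e] at hab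
    have := H.inj _ (by split_ifs <;> assumption) _ (by split_ifs <;> assumption) hab
    split_ifs at this <;> omega

/-- A permutation of the natural numbers below `N`, as a permutation of `Fin N`. -/
noncomputable def IsPermOn.toPerm {N : ℕ} {h : ℕ → ℕ} (H : IsPermOn N h) : Equiv.Perm (Fin N) :=
  Equiv.ofBijective (fun a => ⟨h a, H.lt a a.2⟩) <| Finite.injective_iff_bijective.1 fun a b hab =>
    Fin.ext (H.inj a a.2 b b.2 (by simpa using hab))

@[simp] theorem IsPermOn.toPerm_apply {N : ℕ} {h : ℕ → ℕ} (H : IsPermOn N h) (a : Fin N) :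
    (H.toPerm a : ℕ) = h a := rfl

theorem IsPermOn.exists_eq {N : ℕ} {h : ℕ → ℕ} (H : IsPermOn N h) {i : ℕ} (hi : i < N) :
    ∃ a < N, h a = i := by
  refine ⟨H.toPerm.symm ⟨i, hi⟩, Fin.is_lt _, ?_⟩
  rw [← H.toPerm_apply, Equiv.apply_symm_apply]

theorem GrowInv.reached {W : ℕ → ℕ → ℝ} {h : ℕ → ℕ} {N c : ℕ} {y : ℕ → ℝ} {rk nx : ℕ → ℕ}
    (H : GrowInv W h N c (N - 1) y rk nx) {a : ℕ} (ha : a < N) : rk a ≠ 0 := by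
  have h1 : (Finset.range N).filter (fun a => rk a ≠ 0) = Finset.range N := by
    refine Finset.eq_of_subset_of_card_le (Finset.filter_subset _ _) ?_
    rw [H.card, Finset.card_range]; omega
  have h2 := Finset.mem_range.2 ha
  rw [← h1] at h2
  exact (Finset.mem_filter.1 h2).2

/-- Move the agents along the path in the tree from the bundle that is given by the natural scalar
`6` to the root, the natural scalar `5`, and the holder of the root to the start of the path. -/
def rotateP : Program :=
  .loop (.not (.neq (.var 6) (.var 5))) <|
  .seq (.setN 13 (holderE (.var 6))) <|
  .seq (.storeN 3 (.lit 0) (.var 6) (holderE (.var 5))) <|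
  .seq (.storeN 3 (.lit 0) (.var 5) (.var 13)) <|
  .setN 6 (parentE (.var 6))

/-- The invariant of `rotateP`: the holder of the root `c` demands the bundle `x`, and the other
agents demand the bundles that they hold. -/
structure RotateInv (W : ℕ → ℕ → ℝ) (N c : ℕ) (y : ℕ → ℝ) (rk nx h : ℕ → ℕ) (x : ℕ) : Prop where
  perm : IsPermOn N h
  lt : x < N
  nonneg : ∀ a < N, a ≠ c → ∀ b < N, 0 ≤ slack W h y a b
  -- Tightness is kept only on the part of the tree not yet passed; bundles of higher rank may have
  -- changed holders.
  tight : ∀ a < N, a ≠ c → rk a ≤ rk x → slack W h y a (nx a) = 0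
  best : ∀ b < N, y b + W (h c) b ≤ y x + W (h c) x

/-- The holder of the root moves to `x`, which it demands. The former holder of `x` moves to the
root and demands the parent of `x`, because that edge was tight. -/
theorem RotateInv.step {W : ℕ → ℕ → ℝ} {N c : ℕ} {y : ℕ → ℝ} {rk nx h h' : ℕ → ℕ} {x : ℕ}
    (H : RotateInv W N c y rk nx h x) (hc : c < N) (hxc : x ≠ c) (hnx : nx x < N)
    (hrk : rk (nx x) < rk x)
    (hh : ∀ a, h' a = if a = c then h x else if a = x then h c else h a) :
    RotateInv W N c y rk nx h' (nx x) := by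
  have hc' : h' c = h x := by rw [hh, if_pos rfl]
  have hx' : h' x = h c := by rw [hh, if_neg hxc, if_pos rfl]
  have ho' : ∀ a, a ≠ c → a ≠ x → h' a = h a := fun a h1 h2 => by rw [hh, if_neg h1, if_neg h2]
  refine ⟨H.perm.swap hc H.lt hh, hnx, fun a ha hac b hb => ?_, fun a ha hac hle => ?_,
    fun b hb => ?_⟩
  · by_cases hax : a = x
    · simp only [slack, hax, hx']
      linarith [H.best b hb]
    · simpa only [slack, ho' a hac hax] using H.nonneg a ha hac b hb
  · have hax : a ≠ x := by rintro rfl; omega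
    simpa only [slack, ho' a hac hax] using H.tight a ha hac (by omega)
  · have h1 := H.nonneg x H.lt hxc b hb
    have h2 := H.tight x H.lt hxc le_rfl
    simp only [slack] at h1 h2
    rw [hc']
    linarith

theorem runs_rotateP {W : ℕ → ℕ → ℝ} {N c : ℕ} {y : ℕ → ℝ} {rk nx : ℕ → ℕ} {s : Store}
    (hN : N ≤ K) (hc : c < N) (hsc : s.nvar 5 = c) (hnx : s.narr 5 0 = nx)
    (H : GrowInv W (s.narr 3 0) N c (N - 1) y rk nx) (hp : IsPermOn N (s.narr 3 0))
    (hb : s.nvar 6 < N) (hbest : ∀ b < N, y b + W (s.narr 3 0 c) b ≤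
      y (s.nvar 6) + W (s.narr 3 0 c) (s.nvar 6)) :
    Runs v K rotateP s fun s' => IsPermOn N (s'.narr 3 0) ∧
      ∀ a < N, ∀ b < N, 0 ≤ slack W (s'.narr 3 0) y a b := by
  -- Ranks are at most `N` and drop strictly at each parent, so the rank bounds the number of
  -- rounds.
  refine Runs.loop (N := N) (fun k s' => rk (s'.nvar 6) ≤ k ∧
    RotateInv W N c y rk nx (s'.narr 3 0) (s'.nvar 6)) hN
    ⟨?_, hp, hb, H.nonneg, fun a ha hac _ => H.tight a ha hac (H.reached ha), hbest⟩ ?_ ?_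
  · have := H.rk_le _ hb
    omega
  · rintro k s' hf ⟨hk, hI⟩ hcond
    have e5 : s'.nvar 5 = c := (hf.nvar 5 (by decide)).trans hsc
    have a5 : s'.narr 5 = s.narr 5 := hf.narr 5 (by decide)
    have hxc : s'.nvar 6 ≠ c := by simpa [Test.Holds, e5] using hcond
    have hrk := H.rk_nx _ hI.lt hxc (H.reached hI.lt)
    refine ⟨by omega, Runs.seq (Runs.setN (Runs.seq (Runs.storeN (Runs.seq (Runs.storeN
      (Runs.setN ?_))))))⟩
    have hstep := hI.step hc hxc (H.nx_lt _ hI.lt) hrk (h' := fun a => if a = c then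
      s'.narr 3 0 (s'.nvar 6) else if a = s'.nvar 6 then s'.narr 3 0 c else s'.narr 3 0 a)
      fun _ => rfl
    simp only [holderE, parentE, NExp.eval, Store.nvar_setN, Store.nvar_storeN, Store.narr_setN,
      Store.narr_storeN, e5, a5, hnx, reduceIte, Nat.reduceEqDiff, false_and]
    refine ⟨by omega, ?_⟩
    convert hstep using 1
    funext a
    simp
  · rintro k s' hf ⟨hk, hI⟩ hcond
    have hxc : s'.nvar 6 = c := by
      simpa [Test.Holds, (hf.nvar 5 (by decide)).trans hsc] using hcond
    refine ⟨hI.perm, fun a ha b hb => ?_⟩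
    by_cases hac : a = c
    · have := hI.best b hb
      rw [hxc] at this
      simp only [slack, hac]
      linarith
    · exact hI.nonneg a ha hac b hb

/-! ### The assignment problem of a partial allocation -/

/-- The value of the bundle `A a` for the agent `i`, decreased by `L` if the agent likes it less
than the bundle `A (σ i)`. -/
noncomputable def truncated (v : Valuations n m) (A : ℕ → Finset (Fin m)) (σ : ℕ → ℕ) (L : ℝ)
    (i a : ℕ) : ℝ :=
  if oracle v i (A (σ i)) ≤ oracle v i (A a) then oracle v i (A a) else oracle v i (A a) - L

/-- Make the natural scalar `5` the bundle of the agent that is given by the natural scalar `3`. -/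
def findP : Program :=
  .forTo 2 (.var 0) (.cond (.neq (holderE (.var 2)) (.var 3)) (.setN 5 (.var 2)) .skip)

theorem runs_findP {s : Store} {k : ℕ} (hn : n ≤ K) (hsn : s.nvar 0 = n) (hk : s.nvar 3 = k)
    (hkn : k < n) (hp : IsPermOn n (s.narr 3 0)) :
    Runs v K findP s fun s' => s'.nvar 5 < n ∧ s.narr 3 0 (s'.nvar 5) = k := by
  refine Runs.mono (Runs.forTo n (fun j s' => ∀ a < j, s.narr 3 0 a = k →
    s'.nvar 5 < n ∧ s.narr 3 0 (s'.nvar 5) = k) (by decide) hn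
    (fun s' hf => (hf.nvar 0 (by decide)).trans hsn) (by simp) ?_) ?_
  · rintro j s' hj hsj hf hI
    have e3 : s'.nvar 3 = k := (hf.nvar 3 (by decide)).trans hk
    have a3 : s'.narr 3 = s.narr 3 := hf.narr 3 (by decide)
    refine Runs.cond (fun hb => Runs.setN ?_) (fun hb => Runs.skip ?_)
    · simp only [Test.holds_neq, holderE, NExp.eval, hsj, e3, a3] at hb
      intro a ha _
      simpa [hsj] using ⟨hj, hb⟩
    · simp only [Test.holds_neq, holderE, NExp.eval, hsj, e3, a3] at hb
      intro a ha hak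
      have : a ≠ j := by rintro rfl; exact hb hak
      simpa using hI a (by omega) hak
  · rintro s' - ⟨-, hI⟩
    obtain ⟨a, ha, hak⟩ := hp.exists_eq hkn
    exact hI a ha hak

/-- Query the values of the bundles (the rows of the natural array `1`) for the agent that is given
by the natural scalar `3`. -/
def fillRowP : Program :=
  .seq (.query 2 (.var 3) 1 (.arr 2 (.lit 0) (.var 3))) <|
  .forTo 2 (.var 0) <|
  .seq (.query 3 (.var 3) 1 (.var 2)) <|
  .cond (.rle (.var 2) (.var 3)) (.storeR 1 (.var 3) (.var 2) (.var 3))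
    (.storeR 1 (.var 3) (.var 2) (.sub (.var 3) (.var 1)))

theorem runs_fillRowP {s : Store} {k : ℕ} {A : ℕ → Finset (Fin m)} {σ : ℕ → ℕ} {L : ℝ}
    (hn : n ≤ K) (hm : m + 1 ≤ K) (hsn : s.nvar 0 = n) (hk : s.nvar 3 = k)
    (hA : s.bundle m 1 = A) (hσ : s.narr 2 0 = σ) (hL : s.rvar 1 = L) :
    Runs v K fillRowP s fun s' => ∀ i a, s'.rarr 1 i a =
      if i = k ∧ a < n then truncated v A σ L i a else s.rarr 1 i a := by
  refine Runs.seq (Runs.query hm ?_)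
  simp only [NExp.eval, hk, hσ, hA]
  refine Runs.mono (Runs.forTo n (fun j s' => ∀ i a, s'.rarr 1 i a =
      if i = k ∧ a < j then truncated v A σ L i a else s.rarr 1 i a) (by decide) hn
    (fun s' hf => (hf.nvar 0 (by decide)).trans hsn) (by simp) ?_) fun s' _ h => h.2
  rintro j s' hj hsj hf hI
  have e3 : s'.nvar 3 = k := (hf.nvar 3 (by decide)).trans hk
  have a1 : s'.narr 1 = s.narr 1 := hf.narr 1 (by decide)
  have r1 : s'.rvar 1 = L := (hf.rvar 1 (by decide)).trans hL
  have r2 : s'.rvar 2 = oracle v k (A (σ k)) := by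
    simpa using hf.rvar 2 (by decide)
  have hA' : s'.bundle m 1 = A := by
    rw [← hA]; funext a; simp only [Store.bundle, a1]
  refine Runs.seq (Runs.query hm ?_)
  simp only [NExp.eval, e3, hsj, hA']
  refine Runs.cond (fun hb => Runs.storeR fun i a => ?_) (fun hb => Runs.storeR fun i a => ?_)
  all_goals
    simp only [Test.Holds, RExp.eval, Store.rvar_setR, r2, reduceIte, Nat.reduceEqDiff] at hb
    by_cases hia : i = k ∧ a = j
    · obtain ⟨rfl, rfl⟩ := hia
      simp [e3, hsj, truncated, hb, r1]
    · have : (i = k ∧ a ≤ j) ↔ (i = k ∧ a < j) := by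
        constructor
        · rintro ⟨h1, h2⟩; exact ⟨h1, by omega⟩
        · rintro ⟨h1, h2⟩; exact ⟨h1, by omega⟩
      simp [e3, hsj, hia, hI]
      simp [this]

/-- Take the valuation of the agent that is given by the natural scalar `3` into account. -/
def stageP : Program :=
  .seq findP <| .seq fillRowP <| .seq (.setN 8 (.var 0)) <| .seq growP <|
  .seq (argmaxP (.var 0) .true (.add (priceE (.var 2)) (.arr 1 (.var 3) (.var 2)))) rotateP

/-- A primal-dual step. Rewriting row `k` of the values can upset only the agent `k`, whose bundle
`c` becomes the root of the tree. Agent `k` then picks a best bundle, and the tree path from there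
to `c` repairs the assignment. -/
theorem runs_stageP {s : Store} {k : ℕ} {A : ℕ → Finset (Fin m)} {σ : ℕ → ℕ} {L : ℝ}
    (hn : n ≤ K) (hm : m + 1 ≤ K) (hsn : s.nvar 0 = n) (hk : s.nvar 3 = k) (hkn : k < n)
    (hA : s.bundle m 1 = A) (hσ : s.narr 2 0 = σ) (hL : s.rvar 1 = L)
    (hp : IsPermOn n (s.narr 3 0))
    (hy : ∀ a < n, ∀ b < n, 0 ≤ slack (s.rarr 1) (s.narr 3 0) (s.rarr 2 0) a b) :
    Runs v K stageP s fun s' => IsPermOn n (s'.narr 3 0) ∧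
      (∀ a < n, ∀ b < n, 0 ≤ slack (s'.rarr 1) (s'.narr 3 0) (s'.rarr 2 0) a b) ∧
      ∀ i a, s'.rarr 1 i a = if i = k ∧ a < n then truncated v A σ L i a else s.rarr 1 i a := by
  refine Runs.seq' (runs_findP hn hsn hk hkn hp) fun s1 hf1 ⟨hc, hck⟩ => ?_
  have hA1 : s1.bundle m 1 = A := by
    rw [← hA]; funext a; simp only [Store.bundle, hf1.narr 1 (by decide)]
  refine Runs.seq' (runs_fillRowP hn hm ((hf1.nvar 0 (by decide)).trans hsn)
    ((hf1.nvar 3 (by decide)).trans hk) hA1 ((congrFun (hf1.narr 2 (by decide)) 0).trans hσ)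
    ((hf1.rvar 1 (by decide)).trans hL)) fun s2 hf2 hW => ?_
  have e5 : s2.nvar 5 = s1.nvar 5 := hf2.nvar 5 (by decide)
  have e0 : s2.nvar 0 = n := ((hf2.nvar 0 (by decide)).trans (hf1.nvar 0 (by decide))).trans hsn
  have e3 : s2.nvar 3 = k := ((hf2.nvar 3 (by decide)).trans (hf1.nvar 3 (by decide))).trans hk
  have a3 : s2.narr 3 = s.narr 3 := (hf2.narr 3 (by decide)).trans (hf1.narr 3 (by decide))
  have x2 : s2.rarr 2 = s.rarr 2 := (hf2.rarr 2 (by decide)).trans (hf1.rarr 2 (by decide))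
  have x1 : s1.rarr 1 = s.rarr 1 := hf1.rarr 1 (by decide)
  rw [x1] at hW
  set c := s1.nvar 5 with hcdef
  refine Runs.seq (Runs.setN ?_)
  simp only [NExp.eval, e0]
  refine Runs.seq' (runs_growP (N := n) (c := c) (W := s2.rarr 1) (h := s.narr 3 0) hn hc (by simp)
    (by simp [e5]) (by simp) (by simp [a3]) ?_) fun s3 hf3 hgrow => ?_
  · intro a ha hac b hb
    have hak : s.narr 3 0 a ≠ k := fun h => hac (hp.inj a ha c hc (h.trans hck.symm))
    have := hy a ha b hb
    simpa [slack, hW, hak, x2] using this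
  have g0 : s3.nvar 0 = n := (hf3.nvar 0 (by decide)).trans (by simp [e0])
  have g3 : s3.nvar 3 = k := (hf3.nvar 3 (by decide)).trans (by simp [e3])
  have g5 : s3.nvar 5 = c := (hf3.nvar 5 (by decide)).trans (by simp [e5])
  have b3 : s3.narr 3 = s.narr 3 := (hf3.narr 3 (by decide)).trans (by simpa using a3)
  have y1 : s3.rarr 1 = s2.rarr 1 := (hf3.rarr 1 (by decide)).trans (by simp)
  refine Runs.seq' (runs_argmaxP n (fun _ => True) (fun a => s3.rarr 2 0 a + s2.rarr 1 k a) hn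
    (fun s' hf => (hf.nvar 0 (by decide)).trans g0) (fun s' hf => by simp) (fun s' hf => ?_)
    ⟨k, hkn, trivial⟩) fun s4 hf4 ⟨hb, _, _, hbest⟩ => ?_
  · simp [priceE, hf.rarr 2 (by decide), hf.rarr 1 (by decide), hf.nvar 3 (by decide), g3, y1]
  have c3 : s4.narr 3 = s.narr 3 := (hf4.narr 3 (by decide)).trans b3
  have c5 : s4.narr 5 = s3.narr 5 := hf4.narr 5 (by decide)
  have h5 : s4.nvar 5 = c := (hf4.nvar 5 (by decide)).trans g5
  refine (runs_rotateP (N := n) (W := s2.rarr 1) (rk := s3.narr 4 0) (y := s3.rarr 2 0) hn hc h5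
    (congrFun c5 0) (by rw [c3]; exact hgrow) (by rw [c3]; exact hp) hb ?_).mono ?_
  · intro b hbn
    rw [c3, hck]
    exact hbest b hbn trivial
  · rintro s5 hf5 ⟨hp5, hy5⟩
    have z1 : s5.rarr 1 = s2.rarr 1 :=
      (hf5.rarr 1 (by decide)).trans ((hf4.rarr 1 (by decide)).trans y1)
    have z2 : s5.rarr 2 = s3.rarr 2 := (hf5.rarr 2 (by decide)).trans (hf4.rarr 2 (by decide))
    rw [z1, z2]
    exact ⟨hp5, hy5, hW⟩

/-- Start with zero valuations, zero prices, and bundle `i` assigned to agent `i`. -/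
def startP : Program :=
  .forTo 10 (.var 0) <|
  .seq (.storeN 3 (.lit 0) (.var 10) (.var 10)) <|
  .seq (.storeR 2 (.lit 0) (.var 10) .zero) <|
  .forTo 2 (.var 0) (.storeR 1 (.var 10) (.var 2) .zero)

theorem runs_startP {s : Store} (hn : n ≤ K) (hsn : s.nvar 0 = n) :
    Runs v K startP s fun s' => ∀ i < n, s'.narr 3 0 i = i ∧ s'.rarr 2 0 i = 0 ∧
      ∀ a < n, s'.rarr 1 i a = 0 := by
  refine Runs.mono (Runs.forTo n (fun k s' => ∀ i < k, s'.narr 3 0 i = i ∧ s'.rarr 2 0 i = 0 ∧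
      ∀ a < n, s'.rarr 1 i a = 0) (by decide) hn (fun s' hf => (hf.nvar 0 (by decide)).trans hsn)
      (by simp) ?_) fun s' _ h => h.2
  rintro k s' hk hsk hf hI
  refine Runs.seq (Runs.storeN (Runs.seq (Runs.storeR ?_)))
  simp only [NExp.eval, RExp.eval, hsk, Store.nvar_storeN]
  refine Runs.mono (Runs.forTo n (fun j s'' => (∀ i < k, ∀ a < n, s''.rarr 1 i a = 0) ∧
    ∀ a < j, s''.rarr 1 k a = 0) (by decide) hn
    (fun s' hf' => (hf'.nvar 0 (by decide)).trans ((hf.nvar 0 (by decide)).trans hsn)) ?_ ?_) ?_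
  · simpa using fun i hi => (hI i hi).2.2
  · rintro j s'' hj hsj hf' ⟨h1, h2⟩
    have e10 : s''.nvar 10 = k := (hf'.nvar 10 (by decide)).trans (by simpa using hsk)
    refine Runs.storeR ?_
    simp only [NExp.eval, RExp.eval, e10, hsj, Store.rarr_setN, Store.rarr_storeR]
    refine ⟨fun i hi a ha => ?_, fun a ha => ?_⟩
    · simp [hi.ne, h1 i hi a ha]
    · by_cases haj : a = j
      · simp [haj]
      · simpa [haj] using h2 a (by omega)
  · rintro s'' hf' ⟨-, h1, h2⟩ i hi
    have a3 := hf'.narr 3 (by decide)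
    have a2 := hf'.rarr 2 (by decide)
    simp only [Store.narr_setN, Store.rarr_setN, a3, a2]
    by_cases hik : i = k
    · subst hik
      exact ⟨by simp, by simp, h2⟩
    · have hi' : i < k := by omega
      exact ⟨by simp [hik, (hI i hi').1], by simp [hik, (hI i hi').2.1], h1 i hi'⟩

/-- Let the row `0` of the natural array `2` be the inverse of the row `0` of the natural array
`3`. -/
def invertP : Program :=
  .forTo 2 (.var 0) (.storeN 2 (.lit 0) (holderE (.var 2)) (.var 2))

theorem runs_invertP {s : Store} (hn : n ≤ K) (hsn : s.nvar 0 = n)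
    (hp : IsPermOn n (s.narr 3 0)) :
    Runs v K invertP s fun s' => ∀ a < n, s'.narr 2 0 (s.narr 3 0 a) = a := by
  refine Runs.mono (Runs.forTo n (fun k s' => ∀ a < k, s'.narr 2 0 (s.narr 3 0 a) = a)
    (by decide) hn (fun s' hf => (hf.nvar 0 (by decide)).trans hsn) (by simp) ?_) fun s' _ h => h.2
  rintro k s' hk hsk hf hI
  have a3 : s'.narr 3 = s.narr 3 := hf.narr 3 (by decide)
  refine Runs.storeN fun a ha => ?_
  simp only [holderE, NExp.eval, hsk, a3, Store.narr_setN, Store.narr_storeN, true_and]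
  by_cases hak : a = k
  · simp [hak]
  · have : s.narr 3 0 a ≠ s.narr 3 0 k := fun h => hak (hp.inj a (by omega) k hk h)
    simpa [this] using hI a (by omega)

/-- Compute an optimal assignment of the bundles, with envy-free prices. -/
def matchP : Program :=
  .seq startP <| .seq (.forTo 3 (.var 0) stageP) invertP

/-- Zero values and prices are envy-free to begin with, and each stage brings in one agent. The
array `2` keeps the old assignment `σ` until `invertP` overwrites it at the end, so the truncation
refers to the old one. -/
theorem runs_matchP {s : Store} {A : ℕ → Finset (Fin m)} {σ : ℕ → ℕ} {L : ℝ}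
    (hn : n ≤ K) (hm : m + 1 ≤ K) (hsn : s.nvar 0 = n)
    (hA : s.bundle m 1 = A) (hσ : s.narr 2 0 = σ) (hL : s.rvar 1 = L) :
    Runs v K matchP s fun s' => IsPermOn n (s'.narr 3 0) ∧
      (∀ a < n, ∀ b < n, 0 ≤ slack (s'.rarr 1) (s'.narr 3 0) (s'.rarr 2 0) a b) ∧
      (∀ i < n, ∀ a < n, s'.rarr 1 i a = truncated v A σ L i a) ∧
      ∀ a < n, s'.narr 2 0 (s'.narr 3 0 a) = a := by
  refine Runs.seq' (runs_startP hn hsn) fun s1 hf1 h1 => ?_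
  have e0 : s1.nvar 0 = n := (hf1.nvar 0 (by decide)).trans hsn
  refine Runs.seq' (Q' := fun s' => s'.nvar 3 = n ∧ IsPermOn n (s'.narr 3 0) ∧
      (∀ a < n, ∀ b < n, 0 ≤ slack (s'.rarr 1) (s'.narr 3 0) (s'.rarr 2 0) a b) ∧
      (∀ i < n, ∀ a < n, s'.rarr 1 i a = truncated v A σ L i a)) ?_ ?_
  · refine Runs.forTo n (fun k s' => IsPermOn n (s'.narr 3 0) ∧
      (∀ a < n, ∀ b < n, 0 ≤ slack (s'.rarr 1) (s'.narr 3 0) (s'.rarr 2 0) a b) ∧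
      (∀ i < k, ∀ a < n, s'.rarr 1 i a = truncated v A σ L i a)) (by decide) hn
      (fun s' hf => (hf.nvar 0 (by decide)).trans e0) ?_ ?_
    · refine ⟨⟨fun a ha => ?_, fun a ha b hb => ?_⟩, fun a ha b hb => ?_, by simp⟩
      · simpa [(h1 a ha).1] using ha
      · simp [(h1 a ha).1, (h1 b hb).1]
      · simp [slack, h1 a ha, h1 b hb, (h1 a ha).2.2 a ha, (h1 a ha).2.2 b hb]
    · rintro k s' hk hsk hf ⟨hp, hy, hW⟩
      have hA' : s'.bundle m 1 = A := by
        rw [← hA]; funext a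
        simp only [Store.bundle, hf.narr 1 (by decide), hf1.narr 1 (by decide)]
      refine (runs_stageP hn hm ((hf.nvar 0 (by decide)).trans e0) hsk hk hA'
        ((congrFun ((hf.narr 2 (by decide)).trans (hf1.narr 2 (by decide))) 0).trans hσ)
        (((hf.rvar 1 (by decide)).trans (hf1.rvar 1 (by decide))).trans hL) hp hy).mono ?_
      rintro s'' - ⟨hp', hy', hW'⟩
      refine ⟨hp', hy', fun i hi a ha => ?_⟩
      simp only [Store.rarr_setN, hW']
      by_cases hik : i = k
      · simp [hik, ha]
      · simpa [hik] using hW i (by omega) a ha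
  · rintro s2 hf2 ⟨-, hp, hy, hW⟩
    refine (runs_invertP hn ((hf2.nvar 0 (by decide)).trans e0) hp).mono fun s3 hf3 h3 => ?_
    rw [hf3.narr 3 (by decide), hf3.rarr 1 (by decide), hf3.rarr 2 (by decide)]
    exact ⟨hp, hy, hW, h3⟩

/-- Introduce an additional bundle, of the least price, that every agent likes as much as the bundle
assigned to that agent. -/
def dummyP : Program :=
  .seq (argmaxP (.var 0) .true (.sub .zero (priceE (.var 2)))) <|
  .seq (.forTo 2 (.var 0) (.storeR 1 (holderE (.var 2)) (.var 0)
    (.arr 1 (holderE (.var 2)) (.var 2)))) <|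
  .seq (.storeR 2 (.lit 0) (.var 0) (priceE (.var 6))) <|
  .seq (.setN 5 (.var 0)) (.setN 8 (.add (.var 0) (.lit 1)))

theorem runs_dummyP {s : Store} (hn : n ≤ K) (hn0 : 0 < n) (hsn : s.nvar 0 = n)
    (hp : IsPermOn n (s.narr 3 0))
    (hy : ∀ a < n, ∀ b < n, 0 ≤ slack (s.rarr 1) (s.narr 3 0) (s.rarr 2 0) a b) :
    Runs v K dummyP s fun s' => s'.nvar 5 = n ∧ s'.nvar 8 = n + 1 ∧
      (∀ a < n + 1, a ≠ n → ∀ b < n + 1,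
        0 ≤ slack (s'.rarr 1) (s.narr 3 0) (s'.rarr 2 0) a b) ∧
      (∀ i < n, ∀ a < n, s'.rarr 1 i a = s.rarr 1 i a) ∧
      ∀ a < n, s'.rarr 1 (s.narr 3 0 a) n = s.rarr 1 (s.narr 3 0 a) a := by
  refine Runs.seq' (runs_argmaxP n (fun _ => True) (fun a => -s.rarr 2 0 a) hn
    (fun s' hf => (hf.nvar 0 (by decide)).trans hsn) (fun s' hf => by simp) (fun s' hf => ?_)
    ⟨0, hn0, trivial⟩) fun s1 hf1 ⟨hb, _, _, hbest⟩ => ?_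
  · simp [priceE, hf.rarr 2 (by decide)]
  have e0 : s1.nvar 0 = n := (hf1.nvar 0 (by decide)).trans hsn
  have a3 : s1.narr 3 = s.narr 3 := hf1.narr 3 (by decide)
  have x1 : s1.rarr 1 = s.rarr 1 := hf1.rarr 1 (by decide)
  have x2 : s1.rarr 2 = s.rarr 2 := hf1.rarr 2 (by decide)
  refine Runs.seq' (Q' := fun s' => s'.nvar 2 = n ∧ (∀ i, ∀ a < n, s'.rarr 1 i a = s.rarr 1 i a) ∧
      ∀ a < n, s'.rarr 1 (s.narr 3 0 a) n = s.rarr 1 (s.narr 3 0 a) a) ?_ ?_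
  · refine Runs.forTo n (fun k s' => (∀ i, ∀ a < n, s'.rarr 1 i a = s.rarr 1 i a) ∧
      ∀ a < k, s'.rarr 1 (s.narr 3 0 a) n = s.rarr 1 (s.narr 3 0 a) a) (by decide) hn
      (fun s' hf => (hf.nvar 0 (by decide)).trans e0) (by simp [x1]) ?_
    rintro k s' hk hsk hf ⟨h1, h2⟩
    have b3 : s'.narr 3 = s.narr 3 := (hf.narr 3 (by decide)).trans a3
    have b0 : s'.nvar 0 = n := (hf.nvar 0 (by decide)).trans e0
    refine Runs.storeR ?_
    simp only [holderE, NExp.eval, RExp.eval, hsk, b3, b0, Store.rarr_setN, Store.rarr_storeR,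
      true_and, and_true]
    refine ⟨fun i a ha => by simp [ha.ne, h1 i a ha], fun a ha => ?_⟩
    by_cases hak : a = k
    · simp [hak, h1 _ k hk]
    · have : s.narr 3 0 a ≠ s.narr 3 0 k := fun h => hak (hp.inj a (by omega) k hk h)
      simpa [this] using h2 a (by omega)
  · rintro s2 hf2 ⟨-, h1, h2⟩
    have f0 : s2.nvar 0 = n := (hf2.nvar 0 (by decide)).trans e0
    have f6 : s2.nvar 6 = s1.nvar 6 := hf2.nvar 6 (by decide)
    have y2 : s2.rarr 2 = s.rarr 2 := (hf2.rarr 2 (by decide)).trans x2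
    refine Runs.seq (Runs.storeR (Runs.seq (Runs.setN (Runs.setN ?_))))
    simp only [priceE, NExp.eval, RExp.eval, f0, f6, y2, Store.nvar_setN, Store.rarr_setN,
      Store.nvar_storeR, Store.rarr_storeR, reduceIte, Nat.reduceEqDiff, false_and, true_and]
    refine ⟨fun a ha han b hb => ?_, fun i _ => h1 i, h2⟩
    have ha' : a < n := by omega
    by_cases hbn : b = n
    · have := hbest a ha' trivial
      simp only [slack, Store.rarr_storeR, true_and, if_neg han, hbn, if_true, y2,
        reduceIte, Nat.reduceEqDiff, false_and, h1 _ a ha', h2 a ha']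
      linarith
    · have hb' : b < n := by omega
      have := hy a ha' b hb'
      simpa [slack, han, hbn, y2, h1 _ a ha', h1 _ b hb'] using this

/-- Compute an optimal assignment of the bundles, with minimal envy-free prices. -/
def solveP : Program :=
  .seq matchP <| .seq dummyP growP

/-- The prices that are stored in the memory, relative to the price of the additional bundle. -/
def storedPrice (n : ℕ) (s : Store) (a : Fin n) : ℝ := s.rarr 2 0 a - s.rarr 2 0 n

/-- Parents in the tree are the tight paths required by `reach`, with `rk` as rank. A parent equal
to the additional bundle `n` means relative price zero. -/
theorem GrowInv.minimalPrices {W : ℕ → ℕ → ℝ} {h : ℕ → ℕ} {y : ℕ → ℝ} {rk nx : ℕ → ℕ}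
    (H : GrowInv W h (n + 1) n n y rk nx) (hp : IsPermOn n h)
    (hW : ∀ a < n, W (h a) n = W (h a) a) :
    MinimalPrices (fun i a : Fin n => W i a) hp.toPerm (fun a => y a - y n) where
  nonneg a := by
    have := H.nonneg a (by omega) (by omega) n (by omega)
    simp only [slack, hW a a.2] at this
    linarith
  demand a b := by
    have := H.nonneg a (by omega) (by omega) b (by omega)
    simp only [slack] at this
    simp only [IsPermOn.toPerm_apply]
    linarith
  reach := by
    refine ⟨fun a => rk a, fun a => ?_⟩
    have hr := H.reached (a := a) (by omega)
    have h1 := H.tight a (by omega) (by omega) hr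
    have h2 := H.rk_nx a (by omega) (by omega) hr
    have h3 := H.nx_lt a (by omega)
    simp only [slack] at h1
    by_cases hn : nx a = n
    · left
      rw [hn, hW a a.2] at h1
      linarith
    · refine Or.inr ⟨⟨nx a, by omega⟩, h2, ?_⟩
      simp only [IsPermOn.toPerm_apply]
      linarith

/-- With penalty zero the truncated valuations are the true ones, whatever assignment the array `2`
holds. -/
theorem runs_solveP {s : Store} {A : ℕ → Finset (Fin m)} (hn : n + 1 ≤ K) (hm : m + 1 ≤ K)
    (hn0 : 0 < n) (hsn : s.nvar 0 = n) (hA : s.bundle m 1 = A) (hL : s.rvar 1 = 0) :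
    Runs v K solveP s fun s' => ∃ hp : IsPermOn n (s'.narr 3 0),
      MinimalPrices (fun i a : Fin n => v i (A a)) hp.toPerm (storedPrice n s') ∧
      ∀ a < n, s'.narr 2 0 (s'.narr 3 0 a) = a := by
  refine Runs.seq' (runs_matchP (by omega) hm hsn hA rfl hL) fun s1 hf1 ⟨hp, hy, hW, hi⟩ => ?_
  have e0 : s1.nvar 0 = n := (hf1.nvar 0 (by decide)).trans hsn
  refine Runs.seq' (runs_dummyP (by omega) hn0 e0 hp hy) fun s2 hf2 ⟨h5, h8, hy2, hW2, hd⟩ => ?_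
  have a3 : s2.narr 3 = s1.narr 3 := hf2.narr 3 (by decide)
  refine (runs_growP hn (by omega) h8 h5 rfl (congrFun a3 0) hy2).mono fun s3 hf3 H => ?_
  have b3 : s3.narr 3 = s1.narr 3 := (hf3.narr 3 (by decide)).trans a3
  have b2 : s3.narr 2 = s1.narr 2 := (hf3.narr 2 (by decide)).trans (hf2.narr 2 (by decide))
  rw [b3, b2]
  refine ⟨hp, ?_, hi⟩
  have hmin := H.minimalPrices hp fun a ha => by rw [hd a ha, hW2 _ (hp.lt a ha) a ha]
  have : (fun i a : Fin n => s2.rarr 1 i a) = fun i a : Fin n => v i (A a) := by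
    funext i a
    rw [hW2 i i.2 a a.2, hW i i.2 a a.2]
    simp [truncated, oracle]
  rw [this] at hmin
  exact hmin

/-! ### Allocations that are envy-free up to one item -/

theorem IsMonotoneInstance.mono (hv : IsMonotoneInstance v) (i : Fin n) {X Y : Finset (Fin m)}
    (h : X ⊆ Y) : v i X ≤ v i Y := by
  suffices ∀ Z : Finset (Fin m), v i X ≤ v i (X ∪ Z) by
    simpa [Finset.union_eq_right.2 h] using this Y
  intro Z
  induction Z using Finset.induction_on with
  | empty => simp
  | insert e Z _ ih =>
    rw [Finset.union_insert]
    by_cases he : e ∈ X ∪ Z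
    · rwa [Finset.insert_eq_of_mem he]
    · exact ih.trans (hv e i _ he)

theorem MarginalsAtMostOne.insert_le (hv : MarginalsAtMostOne v) (i : Fin n) (e : Fin m)
    (X : Finset (Fin m)) : v i (insert e X) ≤ v i X + 1 := by
  by_cases he : e ∈ X
  · rw [Finset.insert_eq_of_mem he]; linarith
  · linarith [(abs_le.1 (hv i e X he)).2]

theorem MarginalsAtMostOne.le_erase (hv : MarginalsAtMostOne v) (i : Fin n) (e : Fin m)
    (X : Finset (Fin m)) : v i X ≤ v i (X.erase e) + 1 := by
  by_cases he : e ∈ X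
  · simpa [Finset.insert_erase he] using hv.insert_le i e (X.erase e)
  · rw [Finset.erase_eq_of_notMem he]; linarith

theorem le_add_of_marginals (hv : MarginalsAtMostOne v) (hv' : IsMonotoneInstance v) (i : Fin n)
    (X Y : Finset (Fin m)) : v i X ≤ v i Y + m := by
  have h1 : v i X ≤ v i ∅ + X.card := by
    induction X using Finset.induction_on with
    | empty => simp
    | insert e X he ih =>
      rw [Finset.card_insert_of_notMem he]
      push_cast
      linarith [hv.insert_le i e X]
  have h2 : (X.card : ℝ) ≤ m := by
    exact_mod_cast (Finset.card_le_univ X).trans_eq (Fintype.card_fin m)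
  linarith [hv'.mono i (Finset.empty_subset Y)]

/-- The items below `k` are partitioned into the bundles `A a` for `a < n`.  If the agents `i` hold
the bundles `A (σ i)`, then nobody envies a nonempty bundle `A a` without its item `l a`. -/
structure PartialAllocation (v : Valuations n m) (k : ℕ) (A : ℕ → Finset (Fin m)) (l σ : ℕ → ℕ) :
    Prop where
  perm : IsPermOn n σ
  cover : ∀ e : Fin m, (e : ℕ) < k → ∃ a < n, e ∈ A a
  lt : ∀ a < n, ∀ e ∈ A a, (e : ℕ) < k
  disjoint : ∀ a < n, ∀ b < n, a ≠ b → Disjoint (A a) (A b)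
  envy : ∀ a < n, A a = ∅ ∨
    ∃ e ∈ A a, (e : ℕ) = l a ∧ ∀ i : Fin n, v i ((A a).erase e) ≤ v i (A (σ i))

/-- Without the new item the bundle `s` is its old self, which nobody envies. For the other bundles
the old witness remains valid because every agent's own value has not decreased. -/
theorem PartialAllocation.insert (hv' : IsMonotoneInstance v)
    {A A' : ℕ → Finset (Fin m)} {l l' σ σ' : ℕ → ℕ} {e : Fin m} (H : PartialAllocation v e A l σ)
    (hσ' : IsPermOn n σ') (hle : ∀ i : Fin n, v i (A (σ i)) ≤ v i (A (σ' i))) {s : ℕ} (hs : s < n)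
    (hun : ∀ i : Fin n, v i (A s) ≤ v i (A (σ' i)))
    (hA' : ∀ a, A' a = if a = s then insert e (A s) else A a)
    (hl' : ∀ a, l' a = if a = s then (e : ℕ) else l a) :
    PartialAllocation v (e + 1) A' l' σ' := by
  have he : ∀ a < n, e ∉ A a := fun a ha h => lt_irrefl _ (H.lt a ha e h)
  have hAs : A' s = Insert.insert e (A s) := by rw [hA', if_pos rfl]
  have hAo : ∀ a, a ≠ s → A' a = A a := fun a h => by rw [hA', if_neg h]
  have hsub : ∀ a, A a ⊆ A' a := by
    intro a
    by_cases has : a = s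
    · rw [has, hAs]; exact Finset.subset_insert _ _
    · rw [hAo a has]
  refine ⟨hσ', fun x hx => ?_, fun a ha x hx => ?_, fun a ha b hb hab => ?_, fun a ha => ?_⟩
  · rcases Nat.lt_succ_iff_lt_or_eq.1 hx with hx | hx
    · obtain ⟨a, ha, hxa⟩ := H.cover x hx
      exact ⟨a, ha, hsub a hxa⟩
    · refine ⟨s, hs, ?_⟩
      rw [hAs, Fin.ext hx]
      exact Finset.mem_insert_self _ _
  · by_cases has : a = s
    · rw [has, hAs] at hx
      rcases Finset.mem_insert.1 hx with rfl | hx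
      · omega
      · have := H.lt s hs x hx; omega
    · rw [hAo a has] at hx
      have := H.lt a ha x hx; omega
  · by_cases has : a = s
    · rw [has, hAs, hAo b (by omega), Finset.disjoint_insert_left]
      exact ⟨he b hb, H.disjoint s hs b hb (by omega)⟩
    · by_cases hbs : b = s
      · rw [hbs, hAs, hAo a has, Finset.disjoint_insert_right]
        exact ⟨he a ha, H.disjoint a ha s hs has⟩
      · rw [hAo a has, hAo b hbs]
        exact H.disjoint a ha b hb hab
  · have hup : ∀ i : Fin n, v i (A (σ' i)) ≤ v i (A' (σ' i)) := fun i => hv'.mono i (hsub _)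
    by_cases has : a = s
    · subst has
      refine Or.inr ⟨e, by simp [hAs], by simp [hl'], fun i => ?_⟩
      rw [hAs, Finset.erase_insert (he a ha)]
      exact (hun i).trans (hup i)
    · rw [hAo a has]
      rcases H.envy a ha with h0 | ⟨x, hx, hxl, hxv⟩
      · exact Or.inl h0
      · exact Or.inr ⟨x, hx, by rw [hxl, hl', if_neg has],
          fun i => (hxv i).trans ((hle i).trans (hup i))⟩

/-- In an assignment with envy-free prices for the truncated valuations, everybody is at least as
happy as before, and nobody envies the most expensive bundle. -/
theorem improves_of_slack (hv : MarginalsAtMostOne v) (hv' : IsMonotoneInstance v)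
    {A : ℕ → Finset (Fin m)} {σ h : ℕ → ℕ} {L : ℝ} {W : ℕ → ℕ → ℝ} {y : ℕ → ℝ}
    (hL : (n : ℝ) * m < L) (hσ : IsPermOn n σ) (hh : IsPermOn n h)
    (hy : ∀ a < n, ∀ b < n, 0 ≤ slack W h y a b)
    (hW : ∀ i < n, ∀ a < n, W i a = truncated v A σ L i a) (a : Fin n) :
    v (hh.toPerm a) (A (σ (h a))) ≤ v (hh.toPerm a) (A a) ∧
      ∀ s < n, y a ≤ y s → v (hh.toPerm a) (A s) ≤ v (hh.toPerm a) (A a) := by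
  set u : Fin n → ℝ := fun a => v (hh.toPerm a) (A (σ (h a))) with hu
  have hWv : ∀ a : Fin n, ∀ b < n, W (h a) b =
      if u a ≤ v (hh.toPerm a) (A b) then v (hh.toPerm a) (A b)
      else v (hh.toPerm a) (A b) - L := by
    intro a b hb
    rw [hW _ (hh.lt a a.2) b hb]
    have : ∀ X : Finset (Fin m), oracle v (h a) X = v (hh.toPerm a) X := fun X => by
      rw [oracle, dif_pos (hh.lt a a.2)]; rfl
    simp only [truncated, this, hu]
  -- Compare each holder's bundle with its old one under `σ`. Both assignments are permutations, so
  -- the prices cancel in the sum.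
  have hsum : 0 ≤ ∑ a : Fin n, (W (h a) a - u a) := by
    have h1 : ∀ a : Fin n, y (σ (h a)) - y a ≤ W (h a) a - u a := by
      intro a
      have h2 := hy a a.2 _ (hσ.lt _ (hh.lt a a.2))
      rw [slack, hWv a _ (hσ.lt _ (hh.lt a a.2)), if_pos le_rfl] at h2
      simp only [hu]
      linarith
    refine le_trans (le_of_eq ?_) (Finset.sum_le_sum fun a _ => h1 a)
    rw [Finset.sum_sub_distrib, eq_comm, sub_eq_zero]
    exact Equiv.sum_comp (hh.toPerm.trans hσ.toPerm) fun a : Fin n => y a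
  have hmn : (0 : ℝ) ≤ n * m := by positivity
  have key : ∀ a : Fin n, u a ≤ v (hh.toPerm a) (A a) := by
    intro a0
    by_contra hlt
    -- One agent's loss costs `L > n * m`, more than all the gains, at most `m` each, can
    -- compensate.
    have h1 : ∀ a : Fin n, W (h a) a - u a ≤ m - if a = a0 then L else 0 := by
      intro a
      rw [hWv a a a.2]
      by_cases haa : a = a0
      · subst haa
        rw [if_neg hlt, if_pos rfl]
        have : (0 : ℝ) ≤ m := Nat.cast_nonneg m
        linarith
      · rw [if_neg haa]
        have h2 : v (hh.toPerm a) (A a) ≤ u a + m := le_add_of_marginals hv hv' _ _ _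
        split_ifs <;> linarith
    have h2 := hsum.trans (Finset.sum_le_sum fun a _ => h1 a)
    rw [Finset.sum_sub_distrib, Finset.sum_ite_eq' Finset.univ a0] at h2
    simp at h2
    linarith
  refine ⟨key a, fun s hs hys => ?_⟩
  -- If `A s` is penalized for this agent, it is worth less than the old bundle, hence less than the
  -- new one.
  by_cases hus : u a ≤ v (hh.toPerm a) (A s)
  · have h1 := hy a a.2 s hs
    rw [slack, hWv a a a.2, hWv a s hs, if_pos (key a), if_pos hus] at h1
    linarith
  · exact (not_le.1 hus).le.trans (key a)

/-! ### From minimal prices to the allocation -/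

/-- Relabel the agents. -/
theorem MinimalPrices.relabel {ι : Type*} {w : ι → ι → ℝ} {π : Equiv.Perm ι} {q : ι → ℝ}
    (h : MinimalPrices w π q) (S : Equiv.Perm ι) :
    MinimalPrices (fun i a => w (S.symm i) a) (π.trans S) q :=
  ⟨h.nonneg, fun a b => by simpa using h.demand a b, by simpa using h.reach⟩

/-- The permutation `S` that witnesses bounded envy need not be the assignment `π` that is output;
it serves only to bound the prices. -/
theorem isDesired_of_minimalPrices {A : Fin n → Finset (Fin m)} {π S : Equiv.Perm (Fin n)}
    {q : Fin n → ℝ} (hn : 0 < n) (hA : IsAllocation A)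
    (h : MinimalPrices (fun i a => v i (A a)) π q)
    (hw : EnvyAtMostOne fun i a => v (S.symm i) (A a)) (hq : ∀ a, q a ≤ (n : ℝ) - 3 / 2) :
    IsDesired v (fun i => A (π.symm i)) (fun i => q (π.symm i)) := by
  refine ⟨⟨?_, fun i j hij => hA.2 _ _ (π.symm.injective.ne hij)⟩, fun i => h.nonneg _,
    fun i j => ?_, fun i => hq _, ?_⟩
  · refine Finset.eq_univ_of_forall fun e => ?_
    have he : e ∈ Finset.univ.biUnion A := by rw [hA.1]; exact Finset.mem_univ e
    obtain ⟨a, -, ha⟩ := Finset.mem_biUnion.1 he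
    exact Finset.mem_biUnion.2 ⟨π a, Finset.mem_univ _, by simpa using ha⟩
  · simpa using h.demand (π.symm i) (π.symm j)
  · rw [Equiv.sum_comp π.symm q]
    have : Nonempty (Fin n) := ⟨⟨0, hn⟩⟩
    obtain ⟨s, -, hs⟩ := Finset.exists_max_image Finset.univ q Finset.univ_nonempty
    have := sum_le_of_le_card_below (q := q) (le_card_below fun a ha => by
      simpa using (h.relabel S).exists_below hw a ha) (fun a => hs a (Finset.mem_univ a))
      (by simpa using hq s)
    simpa using this

theorem PartialAllocation.isAllocation {A : ℕ → Finset (Fin m)} {l σ : ℕ → ℕ}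
    (H : PartialAllocation v m A l σ) : IsAllocation fun a : Fin n => A a := by
  refine ⟨Finset.eq_univ_of_forall fun e => ?_, fun i j hij => H.disjoint i i.2 j j.2 ?_⟩
  · obtain ⟨a, ha, hea⟩ := H.cover e e.2
    exact Finset.mem_biUnion.2 ⟨⟨a, ha⟩, Finset.mem_univ _, hea⟩
  · exact fun h => hij (Fin.ext h)

theorem PartialAllocation.envyAtMostOne (hv : MarginalsAtMostOne v) (hv' : IsMonotoneInstance v)
    {k : ℕ} {A : ℕ → Finset (Fin m)} {l σ : ℕ → ℕ} (H : PartialAllocation v k A l σ) :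
    EnvyAtMostOne fun i a : Fin n => v (H.perm.toPerm.symm i) (A a) := by
  intro j a
  obtain ⟨i, rfl⟩ := H.perm.toPerm.surjective j
  simp only [Equiv.symm_apply_apply, IsPermOn.toPerm_apply]
  rcases H.envy a a.2 with h0 | ⟨e, -, -, he⟩
  · rw [h0]
    linarith [hv'.mono i (Finset.empty_subset (A (σ i)))]
  · linarith [he i, hv.le_erase i e (A a)]

/-- Move the item `e` from the bundle `t` to the bundle `s`. -/
def moveItem {ι : Type*} [DecidableEq ι] (A : ι → Finset (Fin m)) (e : Fin m) (s t a : ι) :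
    Finset (Fin m) :=
  if a = s then insert e (A s) else if a = t then (A t).erase e else A a

theorem IsAllocation.moveItem {A : Fin n → Finset (Fin m)} (hA : IsAllocation A) {e : Fin m}
    {s t : Fin n} (he : e ∈ A t) (hst : s ≠ t) : IsAllocation (moveItem A e s t) := by
  have hmem : ∀ x a, x ∈ FairDivision.moveItem A e s t a ↔
      if x = e then a = s else x ∈ A a := by
    intro x a
    have hea : ∀ a, e ∈ A a → a = t := fun a ha => by
      by_contra hat
      exact Finset.disjoint_left.1 (hA.2 a t hat) ha he
    simp only [FairDivision.moveItem]
    by_cases h1 : a = s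
    · by_cases h2 : x = e <;> simp [h1, h2]
    · by_cases h3 : a = t
      · by_cases h2 : x = e <;> simp [h2, h3, hst.symm]
      · by_cases h2 : x = e
        · simpa [h1, h2, h3] using fun h => h3 (hea a h)
        · simp [h1, h2, h3]
  refine ⟨Finset.eq_univ_of_forall fun x => ?_, fun a b hab => Finset.disjoint_left.2 ?_⟩
  · simp only [Finset.mem_biUnion, Finset.mem_univ, true_and, hmem]
    by_cases hx : x = e
    · exact ⟨s, by simp [hx]⟩
    · have hxu : x ∈ Finset.univ.biUnion A := by rw [hA.1]; exact Finset.mem_univ x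
      obtain ⟨a, -, ha⟩ := Finset.mem_biUnion.1 hxu
      exact ⟨a, by simpa [hx] using ha⟩
  · intro x hxa hxb
    rw [hmem] at hxa hxb
    by_cases hx : x = e
    · simp only [hx, if_true] at hxa hxb
      exact hab (hxa.trans hxb.symm)
    · simp only [hx, if_false] at hxa hxb
      exact Finset.disjoint_left.1 (hA.2 a b hab) hxa hxb

/-- If the prices are large, then moving the item `e` from the cheapest bundle to the most expensive
bundle makes the former unenvied. -/
theorem LargePrices.moveItem (hv : MarginalsAtMostOne v) (hv' : IsMonotoneInstance v)
    {A : Fin n → Finset (Fin m)} {S π : Equiv.Perm (Fin n)} {q : Fin n → ℝ} {s t : Fin n}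
    (h : LargePrices (fun i a => v (S.symm i) (A a)) π q s t) {e : Fin m}
    (he : ∀ i, v (S.symm i) ((A t).erase e) ≤ v (S.symm i) (A i)) :
    s ≠ t ∧ EnvyAtMostOne (fun i a => v (S.symm i) (moveItem A e s t a)) ∧
      (∀ i, v (S.symm i) (moveItem A e s t t) ≤ v (S.symm i) (moveItem A e s t i)) ∧
      ∀ a, v (S.symm t) (moveItem A e s t a) ≤ v (S.symm t) (moveItem A e s t t) + 1 / 2 := by
  have hq0 := h.eq_zero
  have hqs := h.large
  have hcard : (3 : ℝ) ≤ Fintype.card (Fin n) := by exact_mod_cast h.card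
  have hst : s ≠ t := by rintro rfl; linarith
  have hs : FairDivision.moveItem A e s t s = Insert.insert e (A s) := by
    simp [FairDivision.moveItem]
  have ht : FairDivision.moveItem A e s t t = (A t).erase e := by
    simp [FairDivision.moveItem, hst.symm]
  have ho : ∀ a, a ≠ s → a ≠ t → FairDivision.moveItem A e s t a = A a := by
    intro a h1 h2; simp [FairDivision.moveItem, h1, h2]
  have hown : ∀ i, i ≠ t → v (S.symm i) (A i) ≤
      v (S.symm i) (FairDivision.moveItem A e s t i) := by
    intro i hi
    by_cases his : i = s
    · rw [his, hs]; exact hv'.mono _ (Finset.subset_insert _ _)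
    · rw [ho i his hi]
  have hun : ∀ i, v (S.symm i) (FairDivision.moveItem A e s t t) ≤
      v (S.symm i) (FairDivision.moveItem A e s t i) := by
    intro i
    by_cases hit : i = t
    · rw [hit]
    · rw [ht]; exact (he i).trans (hown i hit)
  -- Agent `t` demands `t` at price zero, so it values each other bundle `a` at least `q a > 1/2`
  -- less than `t`; losing `e` costs at most one. For `s`, `q s > 3/2` also absorbs the added item,
  -- and this uses `n ≥ 3`.
  have hhalf : ∀ a, v (S.symm t) (FairDivision.moveItem A e s t a) ≤
      v (S.symm t) (FairDivision.moveItem A e s t t) + 1 / 2 := by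
    intro a
    have h1 := hv.le_erase (S.symm t) e (A t)
    have h2 := h.last_demand a
    by_cases hat : a = t
    · rw [hat]; linarith
    · have h3 := h.half_lt hat
      rw [ht]
      by_cases has : a = s
      · rw [has] at h2
        rw [has, hs]
        linarith [hv.insert_le (S.symm t) e (A s)]
      · rw [ho a has hat]
        linarith
  refine ⟨hst, fun i a => ?_, hun, hhalf⟩
  by_cases hit : i = t
  · rw [hit]; linarith [hhalf a]
  by_cases hat : a = t
  · rw [hat]; linarith [hun i]
  have h1 := hown i hit
  by_cases has : a = s
  · by_cases his : i = s
    · rw [has, his]; linarith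
    -- Nobody envied `s` before, and `e` adds at most one.
    · simp only [has, hs]
      linarith [hv.insert_le (S.symm i) e (A s), h.first_unenvied i]
  · simp only [ho a has hat]
    linarith [h.envy i a]

/-! ### The algorithm -/

theorem Store.bundle_storeN_one (s : Store) (b : ℕ) (e : Fin m) (a : ℕ) :
    (s.storeN 1 b e 1).bundle m 1 a =
      if a = b then insert e (s.bundle m 1 b) else s.bundle m 1 a := by
  ext x
  by_cases ha : a = b
  · by_cases hx : x = e
    · simp [Store.bundle, ha, hx]
    · simp [Store.bundle, ha, hx, Fin.val_inj]
  · simp [Store.bundle, ha]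

theorem Store.bundle_storeN_zero (s : Store) (b : ℕ) (e : Fin m) (a : ℕ) :
    (s.storeN 1 b e 0).bundle m 1 a =
      if a = b then (s.bundle m 1 b).erase e else s.bundle m 1 a := by
  ext x
  by_cases ha : a = b
  · by_cases hx : x = e
    · simp [Store.bundle, ha, hx]
    · simp [Store.bundle, ha, hx, Fin.val_inj]
  · simp [Store.bundle, ha]

theorem Store.bundle_congr {s s' : Store} {a : ℕ} (h : s'.narr a = s.narr a) :
    s'.bundle m a = s.bundle m a := by
  funext k
  simp only [Store.bundle, h]

theorem IsPermOn.inverse {N : ℕ} {h g : ℕ → ℕ} (H : IsPermOn N h) (hg : ∀ a < N, g (h a) = a) :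
    IsPermOn N g := by
  refine ⟨fun i hi => ?_, fun i hi j hj hij => ?_⟩
  · obtain ⟨a, ha, rfl⟩ := H.exists_eq hi
    rwa [hg a ha]
  · obtain ⟨a, ha, rfl⟩ := H.exists_eq hi
    obtain ⟨b, hb, rfl⟩ := H.exists_eq hj
    rw [hg a ha, hg b hb] at hij
    rw [hij]

theorem IsPermOn.toPerm_symm {N : ℕ} {h g : ℕ → ℕ} (H : IsPermOn N h)
    (hg : ∀ a < N, g (h a) = a) (i : Fin N) : (H.toPerm.symm i : ℕ) = g i := by
  obtain ⟨a, rfl⟩ := H.toPerm.surjective i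
  simp [hg a a.2]

/-- Make the real scalar `1` larger than the value of all items for all agents. -/
def penaltyP : Program :=
  .seq (.setR 1 .one) (.forTo 10 (.var 0) (.forTo 2 (.var 1) (.setR 1 (.add (.var 1) .one))))

theorem runs_penaltyP {s : Store} (hn : n ≤ K) (hm : m ≤ K) (hsn : s.nvar 0 = n)
    (hsm : s.nvar 1 = m) : Runs v K penaltyP s fun s' => s'.rvar 1 = n * m + 1 := by
  refine Runs.seq (Runs.setR ?_)
  refine Runs.mono (Runs.forTo n (fun k s' => s'.rvar 1 = k * m + 1) (by decide) hn
    (fun s' hf => (hf.nvar 0 (by decide)).trans hsn) (by simp) ?_) fun s' _ h => h.2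
  rintro k s' hk hsk hf hI
  refine Runs.mono (Runs.forTo m (fun j s' => s'.rvar 1 = k * m + j + 1) (by decide) hm
    (fun s' hf' => (hf'.nvar 1 (by decide)).trans ((hf.nvar 1 (by decide)).trans hsm))
    (by simpa using hI) ?_) ?_
  · rintro j s'' hj hsj hf' hI'
    refine Runs.setR ?_
    simp only [RExp.eval, Store.rvar_setN, Store.rvar_setR, reduceIte, hI']
    push_cast
    ring
  · rintro s'' - ⟨-, h⟩
    simp only [Store.rvar_setN, h]
    push_cast
    ring

/-- Allocate the items one after another, each to a bundle that nobody envies. -/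
def allocateP : Program :=
  .forTo 9 (.var 1) <|
  .seq matchP <|
  .seq (argmaxP (.var 0) .true (priceE (.var 2))) <|
  .seq (.storeN 1 (.var 6) (.var 9) (.lit 1)) (.storeN 6 (.lit 0) (.var 6) (.var 9))

theorem runs_allocateP (hv : MarginalsAtMostOne v) (hv' : IsMonotoneInstance v) {s : Store}
    (hn : n ≤ K) (hm : m + 1 ≤ K) (hn0 : 0 < n) (hsn : s.nvar 0 = n) (hsm : s.nvar 1 = m)
    (hL : s.rvar 1 = n * m + 1) (hσ : IsPermOn n (s.narr 2 0))
    (hA : ∀ a, s.bundle m 1 a = ∅) :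
    Runs v K allocateP s fun s' =>
      PartialAllocation v m (s'.bundle m 1) (s'.narr 6 0) (s'.narr 2 0) := by
  refine Runs.mono (Runs.forTo m (fun k s' =>
    PartialAllocation v k (s'.bundle m 1) (s'.narr 6 0) (s'.narr 2 0)) (by decide) (by omega)
    (fun s' hf => (hf.nvar 1 (by decide)).trans hsm) ?_ ?_) fun s' _ h => h.2
  · have hA0 : ∀ a, (s.setN 9 0).bundle m 1 a = ∅ := hA
    refine ⟨hσ, by simp, fun a _ e he => ?_, fun a _ b _ _ => ?_, fun a _ => Or.inl (hA0 a)⟩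
    · simp [hA0] at he
    · simp [hA0]
  · rintro k s1 hk hsk hf1 H
    have e0 : s1.nvar 0 = n := (hf1.nvar 0 (by decide)).trans hsn
    refine Runs.seq' (runs_matchP hn hm e0 rfl rfl ((hf1.rvar 1 (by decide)).trans hL))
      fun s2 hf2 ⟨hp, hy, hW, hi⟩ => ?_
    have f0 : s2.nvar 0 = n := (hf2.nvar 0 (by decide)).trans e0
    refine Runs.seq' (runs_argmaxP n (fun _ => True) (fun a => s2.rarr 2 0 a) hn
      (fun s' hf => (hf.nvar 0 (by decide)).trans f0) (fun s' hf => by simp) (fun s' hf => ?_)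
      ⟨0, hn0, trivial⟩) fun s3 hf3 ⟨hb, _, _, hbest⟩ => ?_
    · simp [priceE, hf.rarr 2 (by decide)]
    have g9 : s3.nvar 9 = k :=
      (hf3.nvar 9 (by decide)).trans ((hf2.nvar 9 (by decide)).trans hsk)
    have a1 : s3.bundle m 1 = s1.bundle m 1 := Store.bundle_congr
      ((hf3.narr 1 (by decide)).trans (hf2.narr 1 (by decide)))
    have a6 : s3.narr 6 = s1.narr 6 := (hf3.narr 6 (by decide)).trans (hf2.narr 6 (by decide))
    have a2 : s3.narr 2 = s2.narr 2 := hf3.narr 2 (by decide)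
    have himp := improves_of_slack hv hv' (by linarith) H.perm hp hy hW
    refine Runs.seq (Runs.storeN (Runs.storeN ?_))
    simp only [NExp.eval, g9, Store.nvar_storeN]
    -- Properties of the holder of each bundle become properties of each agent's bundle, since the
    -- array `2` is now inverse to the array `3`.
    have hσ2 : ∀ (X : Finset (Fin m) → Fin n → Prop),
        (∀ a : Fin n, X (s1.bundle m 1 a) (hp.toPerm a)) →
        ∀ i : Fin n, X (s1.bundle m 1 (s2.narr 2 0 i)) i := by
      intro X hX i
      obtain ⟨a, rfl⟩ := hp.toPerm.surjective i
      simpa [hi a a.2] using hX a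
    refine H.insert (e := ⟨k, hk⟩) (s := s3.nvar 6) hv' ?_ ?_ hb ?_ ?_ ?_
    · have : ((((s3.storeN 1 (s3.nvar 6) k 1).storeN 6 0 (s3.nvar 6) k).setN 9 (k + 1)).narr 2 0) =
          s2.narr 2 0 := by
        funext i
        simp [a2]
      rw [this]
      exact hp.inverse hi
    · simpa [a2] using hσ2 (fun X i => v i (s1.bundle m 1 (s1.narr 2 0 i)) ≤ v i X)
        fun a => (himp a).1
    · simpa [a2] using hσ2 (fun X i => v i (s1.bundle m 1 (s3.nvar 6)) ≤ v i X)
        fun a => (himp a).2 _ hb (hbest a a.2 trivial)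
    · intro a
      have h1 := Store.bundle_storeN_one s3 (s3.nvar 6) ⟨k, hk⟩ a
      rw [a1] at h1
      exact h1
    · intro a
      simp [a6]

/-- The outcome of the algorithm is ready for the output. -/
def IsSolved (v : Valuations n m) (s : Store) : Prop :=
  ∃ hp : IsPermOn n (s.narr 3 0), (∀ a < n, s.narr 2 0 (s.narr 3 0 a) = a) ∧
    IsDesired v (fun i => s.bundle m 1 (hp.toPerm.symm i))
      (fun i => storedPrice n s (hp.toPerm.symm i))

/-- Write the output. -/
def outputP : Program :=
  .forTo 10 (.var 0) <|
  .seq (.forTo 2 (.var 1) (.storeN 0 (.var 10) (.var 2)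
    (.arr 1 (.arr 2 (.lit 0) (.var 10)) (.var 2))))
  (.storeR 0 (.lit 0) (.var 10)
    (.sub (priceE (.arr 2 (.lit 0) (.var 10))) (priceE (.var 0))))

theorem runs_outputP {s : Store} (hn : n ≤ K) (hm : m ≤ K) (hsn : s.nvar 0 = n)
    (hsm : s.nvar 1 = m) (h : IsSolved v s) :
    Runs v K outputP s fun s' => IsDesired v (outputBundles n m s') (outputSubsidy n s') := by
  refine Runs.mono (Runs.forTo n (fun k s' => ∀ i < k,
    (∀ e < m, s'.narr 0 i e = s.narr 1 (s.narr 2 0 i) e) ∧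
    s'.rarr 0 0 i = s.rarr 2 0 (s.narr 2 0 i) - s.rarr 2 0 n) (by decide) hn
    (fun s' hf => (hf.nvar 0 (by decide)).trans hsn) (by simp) ?_) ?_
  · rintro k s1 hk hsk hf1 hI
    have a1 : s1.narr 1 = s.narr 1 := hf1.narr 1 (by decide)
    have a2 : s1.narr 2 = s.narr 2 := hf1.narr 2 (by decide)
    refine Runs.seq' (Q' := fun s' => s'.nvar 2 = m ∧ ∀ i e, s'.narr 0 i e =
      if i = k ∧ e < m then s.narr 1 (s.narr 2 0 k) e else s1.narr 0 i e) ?_ ?_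
    · refine Runs.forTo m (fun j s' => ∀ i e, s'.narr 0 i e =
        if i = k ∧ e < j then s.narr 1 (s.narr 2 0 k) e else s1.narr 0 i e) (by decide) hm
        (fun s' hf => (hf.nvar 1 (by decide)).trans ((hf1.nvar 1 (by decide)).trans hsm))
        (by simp) ?_
      rintro j s2 hj hsj hf2 hI2
      have b1 : s2.narr 1 = s.narr 1 := (hf2.narr 1 (by decide)).trans a1
      have b2 : s2.narr 2 = s.narr 2 := (hf2.narr 2 (by decide)).trans a2
      have b10 : s2.nvar 10 = k := (hf2.nvar 10 (by decide)).trans hsk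
      refine Runs.storeN fun i e => ?_
      simp only [NExp.eval, hsj, b1, b2, b10, Store.narr_setN, Store.narr_storeN, true_and, hI2]
      by_cases hie : i = k ∧ e = j
      · simp [hie]
      · have : (i = k ∧ e < j + 1) ↔ (i = k ∧ e < j) := by
          constructor
          · rintro ⟨h1, h2⟩; exact ⟨h1, by omega⟩
          · rintro ⟨h1, h2⟩; exact ⟨h1, by omega⟩
        rw [if_neg hie]
        simp only [this]
    · rintro s2 hf2 ⟨-, h2⟩
      have b2 : s2.narr 2 = s.narr 2 := (hf2.narr 2 (by decide)).trans a2
      have b10 : s2.nvar 10 = k := (hf2.nvar 10 (by decide)).trans hsk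
      have b0 : s2.nvar 0 = n :=
        (hf2.nvar 0 (by decide)).trans ((hf1.nvar 0 (by decide)).trans hsn)
      have y2 : s2.rarr 2 = s.rarr 2 := (hf2.rarr 2 (by decide)).trans (hf1.rarr 2 (by decide))
      have y0 : s2.rarr 0 = s1.rarr 0 := hf2.rarr 0 (by decide)
      refine Runs.storeR fun i hi => ?_
      simp only [priceE, NExp.eval, RExp.eval, b2, b10, b0, y2, y0, Store.narr_setN,
        Store.rarr_setN, Store.narr_storeR, Store.rarr_storeR, true_and, h2]
      by_cases hik : i = k
      · subst hik
        exact ⟨fun e he => by simp [he], by simp⟩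
      · have hi' : i < k := by omega
        simpa [hik] using hI i hi'
  · rintro s1 - ⟨-, h1⟩
    obtain ⟨hp, hi, hd⟩ := h
    convert hd using 1
    · funext i
      ext e
      simp [outputBundles, Store.bundle, (h1 i i.2).1 e e.2, hp.toPerm_symm hi]
    · funext i
      simp [outputSubsidy, storedPrice, (h1 i i.2).2, hp.toPerm_symm hi]

/-- The price of the bundle that is given by the natural scalar `11`, relative to the additional
bundle. -/
def maxPriceE : RExp := .sub (priceE (.var 11)) (priceE (.var 0))

/-- If the largest price exceeds `n - 3 / 2`, then move the item last allocated to the cheapest bundle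
to the most expensive bundle, and compute the prices again. -/
def improveP : Program :=
  .seq (argmaxP (.var 0) .true (priceE (.var 2))) <|
  .seq (.setN 11 (.var 6)) <|
  .seq (argmaxP (.var 0) .true (.sub .zero (priceE (.var 2)))) <|
  .seq (.setN 12 (.var 6)) <|
  .seq (.setR 4 .zero) <|
  .seq (.forTo 2 (.var 0) (.setR 4 (.add (.var 4) .one))) <|
  -- The test is `2 * q + 3 ≤ 2 * n`, free of fractions; the real scalar `4` holds `n`, built up by
  -- additions.
  .cond (.rle (.add (.add maxPriceE maxPriceE) (.add .one (.add .one .one)))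
    (.add (.var 4) (.var 4))) .skip <|
  .seq (.storeN 1 (.var 12) (.arr 6 (.lit 0) (.var 12)) (.lit 0)) <|
  .seq (.storeN 1 (.var 11) (.arr 6 (.lit 0) (.var 12)) (.lit 1)) solveP

/-- The reference assignment `σ` is no longer in memory when this is applied; the analysis needs it,
the program does not. -/
theorem runs_improveP (hv : MarginalsAtMostOne v) (hv' : IsMonotoneInstance v) {s : Store}
    {σ : ℕ → ℕ} (hn : n + 1 ≤ K) (hm : m + 1 ≤ K) (hn3 : 3 ≤ n) (hsn : s.nvar 0 = n)
    (hL : s.rvar 1 = 0) (H : PartialAllocation v m (s.bundle m 1) (s.narr 6 0) σ)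
    (hp : IsPermOn n (s.narr 3 0))
    (hq : MinimalPrices (fun i a : Fin n => v i (s.bundle m 1 a)) hp.toPerm (storedPrice n s))
    (hi : ∀ a < n, s.narr 2 0 (s.narr 3 0 a) = a) :
    Runs v K improveP s (IsSolved v) := by
  refine Runs.seq' (runs_argmaxP n (fun _ => True) (fun a => s.rarr 2 0 a) (by omega)
    (fun s' hf => (hf.nvar 0 (by decide)).trans hsn) (fun s' hf => by simp) (fun s' hf => ?_)
    ⟨0, by omega, trivial⟩) fun s1 hf1 ⟨hb, _, _, hbest⟩ => ?_
  · simp [priceE, hf.rarr 2 (by decide)]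
  refine Runs.seq (Runs.setN ?_)
  set x := s1.nvar 6 with hx
  simp only [NExp.eval, ← hx]
  refine Runs.seq' (runs_argmaxP n (fun _ => True) (fun a => -s.rarr 2 0 a) (by omega)
    (fun s' hf => (hf.nvar 0 (by decide)).trans (by simpa using (hf1.nvar 0 (by decide)).trans hsn))
    (fun s' hf => by simp) (fun s' hf => ?_)
    ⟨0, by omega, trivial⟩) fun s2 hf2 ⟨hc, _, _, hcbest⟩ => ?_
  · simp [priceE, hf.rarr 2 (by decide), hf1.rarr 2 (by decide)]
  refine Runs.seq (Runs.setN (Runs.seq (Runs.setR ?_)))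
  set t := s2.nvar 6 with ht
  simp only [NExp.eval, RExp.eval, ← ht]
  have f0 : s2.nvar 0 = n := (hf2.nvar 0 (by decide)).trans
    (by simpa using (hf1.nvar 0 (by decide)).trans hsn)
  have f11 : s2.nvar 11 = x := (hf2.nvar 11 (by decide)).trans (by simp)
  refine Runs.seq' (Q' := fun s' => s'.nvar 2 = n ∧ s'.rvar 4 = n) ?_ ?_
  · refine Runs.forTo n (fun k s' => s'.rvar 4 = k) (by decide) (by omega)
      (fun s' hf => (hf.nvar 0 (by decide)).trans (by simpa using f0)) (by simp) ?_
    rintro k s' hk hsk hf hI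
    refine Runs.setR ?_
    simp [hI]
  rintro s3 hf3 ⟨-, h4⟩
  have g0 : s3.nvar 0 = n := (hf3.nvar 0 (by decide)).trans (by simpa using f0)
  have g11 : s3.nvar 11 = x := (hf3.nvar 11 (by decide)).trans (by simpa using f11)
  have g12 : s3.nvar 12 = t := (hf3.nvar 12 (by decide)).trans (by simp)
  have r1 : s3.rvar 1 = 0 := (hf3.rvar 1 (by decide)).trans
    (by simpa using (hf2.rvar 1 (by decide)).trans ((hf1.rvar 1 (by decide)).trans hL))
  have y2 : s3.rarr 2 = s.rarr 2 := (hf3.rarr 2 (by decide)).trans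
    ((hf2.rarr 2 (by decide)).trans (hf1.rarr 2 (by decide)))
  have harr : ∀ k, s3.narr k = s.narr k := fun k => by
    refine (hf3.narr k ?_).trans ((hf2.narr k ?_).trans (hf1.narr k ?_)) <;>
      simp [argmaxP, Program.forTo]
  have hmax : ∀ a : Fin n, storedPrice n s a ≤ storedPrice n s ⟨x, hb⟩ := fun a =>
    sub_le_sub_right (hbest a a.2 trivial) _
  have hmin : ∀ a : Fin n, storedPrice n s ⟨t, hc⟩ ≤ storedPrice n s a := fun a =>
    sub_le_sub_right (neg_le_neg_iff.1 (hcbest a a.2 trivial)) _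
  have htest : (Test.rle (.add (.add maxPriceE maxPriceE) (.add .one (.add .one .one)))
      (.add (.var 4) (.var 4))).Holds s3 ↔ storedPrice n s ⟨x, hb⟩ ≤ (n : ℝ) - 3 / 2 := by
    simp only [Test.Holds, maxPriceE, priceE, RExp.eval, NExp.eval, g11, g0, h4, y2, storedPrice]
    constructor <;> intro h <;> linarith
  have hallo := H.isAllocation
  refine Runs.cond (fun hb' => Runs.skip ?_) (fun hb' => ?_)
  · rw [htest] at hb'
    refine ⟨by rw [harr]; exact hp, by rw [harr, harr]; exact hi, ?_⟩
    have hbun : s3.bundle m 1 = s.bundle m 1 := Store.bundle_congr (harr 1)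
    have hpr : storedPrice n s3 = storedPrice n s := by
      funext a; simp only [storedPrice, y2]
    simp only [hbun, hpr, harr]
    exact isDesired_of_minimalPrices (by omega) hallo hq (H.envyAtMostOne hv hv')
      fun a => (hmax a).trans hb'
  · rw [htest, not_le] at hb'
    have hlarge : LargePrices
        (fun i a : Fin n => v (H.perm.toPerm.symm i) (s.bundle m 1 a))
        (hp.toPerm.trans H.perm.toPerm) (storedPrice n s) ⟨x, hb⟩ ⟨t, hc⟩ :=
      { hq.relabel H.perm.toPerm with
        envy := H.envyAtMostOne hv hv'
        large := by simpa using hb'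
        max := hmax
        min := hmin
        card := by simpa using hn3 }
    -- The cheapest bundle is envied, hence nonempty, so it has a last item to move.
    obtain ⟨e, het, hel, heun⟩ : ∃ e ∈ s.bundle m 1 t, (e : ℕ) = s.narr 6 0 t ∧
        ∀ i : Fin n, v i ((s.bundle m 1 t).erase e) ≤ v i (s.bundle m 1 (σ i)) := by
      refine (H.envy t hc).resolve_left fun h0 => ?_
      obtain ⟨i, hi⟩ := hlarge.last_envied
      simp only [h0] at hi
      exact absurd hi (not_lt.2 (hv'.mono _ (Finset.empty_subset _)))
    obtain ⟨hst, hen, hun, hhalf⟩ := hlarge.moveItem (A := fun a : Fin n => s.bundle m 1 a) hv hv'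
      (e := e) fun j => by
        obtain ⟨i, rfl⟩ := H.perm.toPerm.surjective j
        simpa using heun i
    refine Runs.seq (Runs.storeN (Runs.seq (Runs.storeN ?_)))
    simp only [NExp.eval, Store.nvar_storeN, g11, g12]
    have hnarr : (s3.storeN 1 t (s3.narr 6 0 t) 0).narr 6 0 t = e := by
      simp [harr, hel]
    rw [hnarr]
    have hnarr' : s3.narr 6 0 t = e := by rw [harr, hel]
    rw [hnarr']
    have hxt : x ≠ t := fun h => hst (Fin.ext h)
    have hA' : (fun a : Fin n => ((s3.storeN 1 t e 0).storeN 1 x e 1).bundle m 1 a) =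
        moveItem (fun a : Fin n => s.bundle m 1 a) e ⟨x, hb⟩ ⟨t, hc⟩ := by
      funext a
      rw [Store.bundle_storeN_one, Store.bundle_storeN_zero, Store.bundle_storeN_zero,
        if_neg hxt, Store.bundle_congr (harr 1)]
      simp [moveItem, Fin.ext_iff]
    have hallo' := hallo.moveItem (e := e) (s := ⟨x, hb⟩) (t := ⟨t, hc⟩) het hst
    rw [← hA'] at hallo' hen hun hhalf
    set s4 := (s3.storeN 1 t e 0).storeN 1 x e 1 with hs4
    refine (runs_solveP hn hm (by omega) (s := s4) g0 rfl r1).mono ?_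
    rintro s5 hf5 ⟨hp5, hq5, hi5⟩
    have hbun : s5.bundle m 1 = s4.bundle m 1 := Store.bundle_congr (hf5.narr 1 (by decide))
    refine ⟨hp5, hi5, ?_⟩
    simp only [hbun]
    -- Bounded envy after the move is still measured by the old reference permutation, although
    -- `solveP` has found a new assignment.
    refine isDesired_of_minimalPrices (S := H.perm.toPerm) (by omega) hallo' hq5 hen fun a => ?_
    have := (hq5.relabel H.perm.toPerm).le_of_unenvied hen (t := ⟨t, hc⟩) (by simp; omega) hun
      hhalf a
    simpa using this

/-- The algorithm. -/
def mainP : Program :=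
  .seq penaltyP <| .seq (mapN 2 (.var 0) .true (.var 2)) <| .seq allocateP <|
  .seq (.setR 1 .zero) <| .seq solveP <| .seq improveP outputP

/-- The bound `n + m + 1` covers loops over agents, items and `n + 1` bundles, as well as the query
cost `m + 1`. -/
theorem runs_mainP (hv : MarginalsAtMostOne v) (hv' : IsMonotoneInstance v) (hn3 : 3 ≤ n) :
    Runs v (n + m + 1) mainP (initialStore n m)
      fun s' => IsDesired v (outputBundles n m s') (outputSubsidy n s') := by
  refine Runs.seq' (runs_penaltyP (by omega) (by omega) rfl rfl) fun s1 hf1 h1 => ?_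
  have b0 : s1.nvar 0 = n := hf1.nvar 0 (by decide)
  have b1 : s1.nvar 1 = m := hf1.nvar 1 (by decide)
  refine Runs.seq' (runs_mapN n (fun _ => True) (fun a => a) (by omega)
    (fun s' hf => (hf.nvar 0 (by decide)).trans b0) (fun s' hf _ _ => by simp)) fun s2 hf2 h2 => ?_
  have c0 : s2.nvar 0 = n := (hf2.nvar 0 (by decide)).trans b0
  have c1 : s2.nvar 1 = m := (hf2.nvar 1 (by decide)).trans b1
  refine Runs.seq' (runs_allocateP hv hv' (by omega) (by omega) (by omega) c0 c1
    ((hf2.rvar 1 (by decide)).trans h1) ⟨fun a ha => ?_, fun a ha b hb hab => ?_⟩ fun a => ?_)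
    fun s3 hf3 H => ?_
  · simp [h2, ha]
  · simpa [h2, ha, hb] using hab
  · simp [Store.bundle, hf2.narr 1 (by decide), hf1.narr 1 (by decide), initialStore]
  have d0 : s3.nvar 0 = n := (hf3.nvar 0 (by decide)).trans c0
  have d1 : s3.nvar 1 = m := (hf3.nvar 1 (by decide)).trans c1
  refine Runs.seq (Runs.setR ?_)
  refine Runs.seq' (runs_solveP (A := s3.bundle m 1) (by omega) (by omega) (by omega)
    (by simpa using d0) rfl (by simp)) fun s4 hf4 ⟨hp, hq, hi⟩ => ?_
  have a1 : s4.bundle m 1 = s3.bundle m 1 := Store.bundle_congr (hf4.narr 1 (by decide))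
  have e0 : s4.nvar 0 = n := (hf4.nvar 0 (by decide)).trans (by simpa using d0)
  have e1 : s4.nvar 1 = m := (hf4.nvar 1 (by decide)).trans (by simpa using d1)
  have a6 : s4.narr 6 = s3.narr 6 := hf4.narr 6 (by decide)
  rw [← a1, ← a6] at H
  rw [← a1] at hq
  refine Runs.seq' (runs_improveP hv hv' (by omega) (by omega) hn3 e0
    ((hf4.rvar 1 (by decide)).trans (by simp)) H hp hq hi) fun s5 hf5 h5 => ?_
  exact runs_outputP (by omega) (by omega) ((hf5.nvar 0 (by decide)).trans e0)
    ((hf5.nvar 1 (by decide)).trans e1) h5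

end FairDivision

/-! ### The main theorem -/

theorem theorem2 :
    -- existence
    (∀ (n m : ℕ), 3 ≤ n → ∀ v : FairDivision.Valuations n m,
      FairDivision.MarginalsAtMostOne v → FairDivision.IsMonotoneInstance v →
        ∃ (A : Fin n → Finset (Fin m)) (p : Fin n → ℝ), FairDivision.IsDesired v A p) ∧
    -- computability by one program, in time polynomial in the numbers of agents and items
    (∃ (P : FairDivision.Program) (C d : ℕ),
      ∀ (n m : ℕ), 3 ≤ n → ∀ v : FairDivision.Valuations n m,
        FairDivision.MarginalsAtMostOne v → FairDivision.IsMonotoneInstance v →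
          ∃ (T : ℕ) (s : FairDivision.Store),
            FairDivision.Exec v P (FairDivision.initialStore n m) T s ∧
            T ≤ C * (n + m) ^ d ∧
            FairDivision.IsDesired v
              (FairDivision.outputBundles n m s) (FairDivision.outputSubsidy n s)) := by
  constructor
  · intro n m hn v hv hv'
    obtain ⟨_, s, -, -, h⟩ := FairDivision.runs_mainP hv hv' hn
    exact ⟨_, _, h⟩
  · obtain ⟨C, d, hC⟩ := FairDivision.mainP.cost_le
    -- The factor `2 ^ d` comes from `n + m + 1 ≤ 2 * (n + m)`.
    refine ⟨FairDivision.mainP, C * 2 ^ d, d, fun n m hn v hv hv' => ?_⟩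
    obtain ⟨T, s, he, hT, h⟩ := FairDivision.runs_mainP hv hv' hn
    refine ⟨T, s, he, (hT.trans (hC _ (by omega))).trans ?_, h⟩
    rw [mul_assoc, ← mul_pow]
    exact Nat.mul_le_mul_left C (Nat.pow_le_pow_left (by omega) d)
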